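/- **Setting.** Let $d,\nu\ge 1$ and $m\ge 0$ be integers. *Diamond Toeplitz graph.* Let $G$ be an undirected weighted graph without self-loops on $\{1,\dots,\nu\}$, with real symmetric adjacency matrix $W$ (so $W$ has zero diagonal). Let $\mathbf t_1,\dots,\mathbf t_m\in\mathbb Z_{\ge0}^d\setminus\{\mathbf 0\}$ be strictly increasing in lexicographic order. Let $[\mathbf t_k]^+$ be the set of vectors $\boldsymbol\alpha=(\pm(t_k)_1,\dots,\pm(t_k)_d)$ whose first nonzero component is positive (one representative for each direction, i.e. each class modulo $\pm$). For every $k$ and every $\boldsymbol\alpha\in[\mathbf t_k]^+$ let $L_{\boldsymbol\alpha}\in\mathbb R^{\nu\times\nu}$ be a nonzero matrix. None of these data depends on $\mathbf n$. For $\mathbf n\in\mathbb N^d$ the $d$-level diamond Toeplitz graph has the nodes $v_{(\mathbf i,r)}$, $\mathbf 1\le\mathbf i\le\mathbf n$ componentwise, $1\le r\le\nu$, and the weights $w_{\mathbf n}(v_{(\mathbf i,r)},v_{(\mathbf j,s)})=(\mathbf w_{\mathbf i-\mathbf j})_{r,s}$, where $\mathbf w_{\mathbf 0}=W$, $\mathbf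 w_{\boldsymbol\alpha}=L_{\boldsymbol\alpha}$ and $\mathbf w_{-\boldsymbol\alpha}=L_{\boldsymbol\alpha}^T$ for $\boldsymbol\alpha\in[\mathbf t_k]^+$, $1\le k\le m$, and $\mathbf w_{\boldsymbol\delta}=0$ otherwise. Its symbol is $$\mathbf f(\boldsymbol\theta)=W+\sum_{k=1}^m\ \sum_{\boldsymbol\alpha\in[\mathbf t_k]^+}\Big[(L_{\boldsymbol\alpha}+L_{\boldsymbol\alpha}^T)\cos(\boldsymbol\alpha\cdot\boldsymbol\theta)+(L_{\boldsymbol\alpha}-L_{\boldsymbol\alpha}^T)\,\mathrm i\sin(\boldsymbol\alpha\cdot\boldsymbol\theta)\Big],\qquad \boldsymbol\theta\in\mathbb R^d .$$ *Grid graph in $\Omega$.* Let $\Omega\subseteq[0,1]^d$ be Lebesgue measurable with positive measure and with boundary of measure zero. Let $p:\Omega\to\mathbb R$ be continuous at almost every point of $\Omega$ (relative to $\Omega$), and extend $p$ to $\mathbb R^d$ by arbitrary values. Immerse the nodes in the open cube by $$\iota(v_{(\mathbf j,r)})=\Big(\frac{(j_1-1)\nu+r}{\nu n_1+1},\frac{j_2}{n_2+1},\dots,\frac{j_d}{n_d+1}\Big).$$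 The diamond Toeplitz grid graph in $\Omega$ has as nodes the $v$ with $\iota(v)\in\Omega$, with weights $p\big(\tfrac{\iota(u)+\iota(v)}2\big)\,w_{\mathbf n}(u,v)$. Let $W_{\mathbf n,\nu}^{G,\Omega,p}$ be its adjacency matrix and $d_{\mathbf n}$ its number of nodes. *Distribution.* For a set $D\subset\mathbb R^M$ with $0<\mu_M(D)<\infty$ ($\mu_M$ Lebesgue measure) and a measurable Hermitian matrix-valued $\mathbf g:D\to\mathbb C^{\nu\times\nu}$, a family of square matrices $X_{\mathbf n}$ of sizes $d_{\mathbf n}\to\infty$ is distributed like $\mathbf g$ in the sense of the eigenvalues, $\{X_{\mathbf n}\}\sim_\lambda\mathbf g$, if for every continuous compactly supported $F:\mathbb C\to\mathbb C$ $$\lim_{\mathbf n\to\infty}\frac1{d_{\mathbf n}}\sum_{k=1}^{d_{\mathbf n}}F(\lambda_k(X_{\mathbf n}))=\frac1{\mu_M(D)}\int_D\frac1\nu\sum_{k=1}^{\nu}F\big(\lambda_k(\mathbf g(\mathbf y))\big)\,d\mu_M(\mathbf y),$$ where $\mathbf n\to\infty$ means $\min_r n_r\to\infty$ and eigenvalues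 are counted with multiplicity. **Theorem.** In this setting, $d_{\mathbf n}\to\infty$ and $$\{W_{\mathbf n,\nu}^{G,\Omega,p}\}_{\mathbf n}\sim_\lambda \mathbf g,\qquad \mathbf g(\mathbf x,\boldsymbol\theta)=p(\mathbf x)\,\mathbf f(\boldsymbol\theta),\quad(\mathbf x,\boldsymbol\theta)\in\Omega\times[-\pi,\pi]^d .$$ Moreover, if $d=1$, or if for every $\boldsymbol\theta\in[-\pi,\pi]^d$ the matrices $\mathbf f(\boldsymbol\theta)$ and $\mathbf f(|\theta_1|,\dots,|\theta_d|)$ have the same characteristic polynomial, then the same holds with $\mathbf g$ restricted to $\Omega\times[0,\pi]^d$. -/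

import Mathlib

open MeasureTheory Filter Topology

namespace DiamondToeplitz

/-- A weighted undirected graph without self-loops on the node set `V`, given by its weight
function; `(u, v)` is an edge exactly when `w u v ≠ 0`. -/
structure WGraph (V : Type*) where
  w : V → V → ℝ
  symm : ∀ u v, w u v = w v u
  loopless : ∀ v, w v v = 0

namespace WGraph

/-- The adjacency matrix of a weighted graph. -/
def adjMatrix {V : Type*} (G : WGraph V) : Matrix V V ℝ := Matrix.of G.w

/-- The sub-graph on the nodes satisfying `P`: the weight function is restricted. -/
def induce {V : Type*} (G : WGraph V) (P : V → Prop) : WGraph {v // P v} where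
  w u v := G.w u v
  symm u v := G.symm u v
  loopless v := G.loopless v

end WGraph

/-- The vectors `(± t 1, …, ± t d)` whose first nonzero component is positive. For `t ≠ 0` there is
exactly one of them in each class modulo `±`, so they represent the set of directions of `t`. -/
def directions {d : ℕ} (t : Fin d → ℕ) : Finset (Fin d → ℤ) :=
  (Fintype.piFinset fun r => {(t r : ℤ), -(t r : ℤ)}).filter
    fun δ => ∃ r, 0 < δ r ∧ ∀ q < r, δ q = 0

theorem mem_directions {d : ℕ} {t : Fin d → ℕ} {δ : Fin d → ℤ} :
    δ ∈ directions t ↔ (∀ r, |δ r| = (t r : ℤ)) ∧ ∃ r, 0 < δ r ∧ ∀ q < r, δ q = 0 := by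
  simp only [directions, Finset.mem_filter, Fintype.mem_piFinset, Finset.mem_insert,
    Finset.mem_singleton]
  refine and_congr_left fun _ => forall_congr' fun r => ?_
  rw [abs_eq (by positivity)]

/-- The data, independent of the size `n`, of a `d`-level diamond Toeplitz graph: a mold graph on
`ν` nodes, nonzero multi-indices `t 1 ◁ … ◁ t m` (strictly increasing lexicographically), and for
every direction of every `t k` a linking-graph operator, i.e. a nonzero real `ν × ν` matrix. -/
structure DiamondData (d m ν : ℕ) where
  mold : WGraph (Fin ν)
  t : Fin m → Fin d → ℕ
  t_ne_zero : ∀ k, t k ≠ 0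
  t_strictMono : StrictMono fun k => toLex (t k)
  L : ∀ k, directions (t k) → Matrix (Fin ν) (Fin ν) ℝ
  L_ne_zero : ∀ k α, L k α ≠ 0

/-- The nodes `v_(i,r)`, with `i` in the `n 1 × … × n d` box and `r` in a diamond.
All indices start from `0`. -/
abbrev Node {d : ℕ} (n : Fin d → ℕ) (ν : ℕ) : Type := ((q : Fin d) → Fin (n q)) × Fin ν

/-- The multi-index difference `i - j`. -/
def idxDiff {d : ℕ} {n : Fin d → ℕ} (i j : (q : Fin d) → Fin (n q)) : Fin d → ℤ :=
  fun q => ((i q : ℕ) : ℤ) - ((j q : ℕ) : ℤ)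

theorem idxDiff_swap {d : ℕ} {n : Fin d → ℕ} (i j : (q : Fin d) → Fin (n q)) :
    idxDiff j i = -idxDiff i j := by
  funext q; simp [idxDiff]

namespace DiamondData

variable {d m ν : ℕ}

/-- The blocks `𝐰_δ` off the diagonal: `L_α` if `δ = α`, `L_αᵀ` if `δ = -α`, for a direction `α`
of some `t k`, and `0` if there is no such direction. A given `δ` satisfies at most one of
these conditions, so at most one summand is nonzero (see `block_pos`, `block_neg`, `block_eq_zero`). -/
def block (S : DiamondData d m ν) (δ : Fin d → ℤ) : Matrix (Fin ν) (Fin ν) ℝ :=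
  ∑ k, ∑ α : directions (S.t k),
    ((if δ = (α : Fin d → ℤ) then S.L k α else 0) +
      (if δ = -(α : Fin d → ℤ) then (S.L k α).transpose else 0))

theorem block_neg_eq (S : DiamondData d m ν) (δ : Fin d → ℤ) :
    S.block (-δ) = (S.block δ).transpose := by
  simp only [block, Matrix.transpose_sum, Matrix.transpose_add]
  refine Finset.sum_congr rfl fun k _ => Finset.sum_congr rfl fun α _ => ?_
  rw [add_comm]
  congr 1
  · by_cases h : δ = (α : Fin d → ℤ)
    · simp [h]
    · have h' : ¬ (-δ = -(α : Fin d → ℤ)) := fun e => h (neg_injective e)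
      simp [h, h']
  · by_cases h : δ = -(α : Fin d → ℤ)
    · simp [h]
    · have h' : ¬ (-δ = (α : Fin d → ℤ)) := fun e => h (by rw [← e, neg_neg])
      simp [h, h']

theorem not_dir_neg {t s : Fin d → ℕ} (α : directions t) (β : directions s) :
    (α : Fin d → ℤ) ≠ -(β : Fin d → ℤ) := by
  obtain ⟨-, r, hr, hr0⟩ := mem_directions.1 α.2
  obtain ⟨-, q, hq, hq0⟩ := mem_directions.1 β.2
  intro h
  have e : ∀ x, (α : Fin d → ℤ) x = -(β : Fin d → ℤ) x := fun x => congrFun h x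
  rcases lt_trichotomy r q with c | c | c
  · have := e r; rw [hq0 r c] at this; omega
  · subst c; have := e r; omega
  · have := e q; rw [hr0 q c] at this; omega

theorem block_pos (S : DiamondData d m ν) (k : Fin m) (α : directions (S.t k)) :
    S.block α = S.L k α := by
  unfold block
  rw [Finset.sum_eq_single k, Finset.sum_eq_single α]
  · rw [if_pos rfl, if_neg (not_dir_neg α α), add_zero]
  · intro β _ hβ
    rw [if_neg (fun h => hβ (Subtype.ext h.symm)), if_neg (not_dir_neg α β), add_zero]
  · simp
  · intro l _ hl
    refine Finset.sum_eq_zero fun β _ => ?_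
    rw [if_neg, if_neg (not_dir_neg α β), add_zero]
    intro h
    apply hl
    apply S.t_strictMono.injective
    change toLex (S.t l) = toLex (S.t k)
    congr 1
    funext r
    have h1 := (mem_directions.1 α.2).1 r
    have h2 := (mem_directions.1 β.2).1 r
    rw [← h] at h2
    exact_mod_cast h2.symm.trans h1
  · simp

theorem block_neg (S : DiamondData d m ν) (k : Fin m) (α : directions (S.t k)) :
    S.block (-(α : Fin d → ℤ)) = (S.L k α).transpose := by
  rw [block_neg_eq, block_pos]

theorem block_eq_zero (S : DiamondData d m ν) (δ : Fin d → ℤ)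
    (h : ∀ k, ∀ α : directions (S.t k), δ ≠ α ∧ δ ≠ -(α : Fin d → ℤ)) : S.block δ = 0 := by
  refine Finset.sum_eq_zero fun k _ => Finset.sum_eq_zero fun α _ => ?_
  rw [if_neg (h k α).1, if_neg (h k α).2, add_zero]

/-- The `d`-level diamond Toeplitz graph of size `n`. -/
def graph (S : DiamondData d m ν) (n : Fin d → ℕ) : WGraph (Node n ν) where
  w u v := if u.1 = v.1 then S.mold.w u.2 v.2 else S.block (idxDiff u.1 v.1) u.2 v.2
  symm u v := by
    by_cases h : u.1 = v.1
    · simp [h, S.mold.symm u.2 v.2]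
    · have h' : ¬ v.1 = u.1 := fun e => h e.symm
      simp only [h, h', if_false]
      rw [idxDiff_swap u.1 v.1, block_neg_eq, Matrix.transpose_apply]
  loopless v := by simp [S.mold.loopless]

/-- The symbol of the diamond Toeplitz graph, a trigonometric polynomial with values in the
complex `ν × ν` matrices. -/
noncomputable def symbol (S : DiamondData d m ν) (θ : Fin d → ℝ) : Matrix (Fin ν) (Fin ν) ℂ :=
  S.mold.adjMatrix.map Complex.ofReal +
    ∑ k, ∑ α : directions (S.t k),
      ((Real.cos (∑ q, ((α : Fin d → ℤ) q : ℝ) * θ q) : ℂ) •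
          (S.L k α + (S.L k α).transpose).map Complex.ofReal +
        (Complex.I * (Real.sin (∑ q, ((α : Fin d → ℤ) q : ℝ) * θ q) : ℂ)) •
          (S.L k α - (S.L k α).transpose).map Complex.ofReal)

end DiamondData

/-- The immersion of the nodes in the open cube: the nodes of the diamonds are lined up along the
first axis, on the grid with steps `1 / (ν n 1 + 1), 1 / (n 2 + 1), …, 1 / (n d + 1)`.
(Indices start from `0`; counted from `1`, the first coordinate is
`((j 1 - 1) ν + r) / (ν n 1 + 1)` and the others are `j q / (n q + 1)`.) -/
noncomputable def immersion {d ν : ℕ} [NeZero d] {n : Fin d → ℕ} (v : Node n ν) : Fin d → ℝ :=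
  fun q =>
    if q = 0 then ((v.1 q : ℕ) * (ν : ℝ) + (v.2 : ℕ) + 1) / ((ν : ℝ) * n q + 1)
    else (((v.1 q : ℕ) : ℝ) + 1) / ((n q : ℝ) + 1)

/-- The diamond Toeplitz grid graph in the cube: the weight between two nodes is multiplied by the
value of `p` at the midpoint of their positions. -/
noncomputable def gridGraph {d m ν : ℕ} [NeZero d] (S : DiamondData d m ν)
    (p : (Fin d → ℝ) → ℝ) (n : Fin d → ℕ) : WGraph (Node n ν) where
  w u v := p ((1 / 2 : ℝ) • (immersion u + immersion v)) * (S.graph n).w u v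
  symm u v := by rw [add_comm, (S.graph n).symm]
  loopless v := by rw [(S.graph n).loopless, mul_zero]

/-- The nodes whose position lies in `Ω`. -/
abbrev NodeIn {d : ℕ} [NeZero d] (Ω : Set (Fin d → ℝ)) (n : Fin d → ℕ) (ν : ℕ) : Type :=
  {v : Node n ν // immersion v ∈ Ω}

noncomputable instance {d : ℕ} [NeZero d] (Ω : Set (Fin d → ℝ)) (n : Fin d → ℕ) (ν : ℕ) :
    Fintype (NodeIn Ω n ν) := Fintype.ofFinite _

/-- The diamond Toeplitz grid graph immersed in `Ω`. -/
noncomputable def gridGraphIn {d m ν : ℕ} [NeZero d] (S : DiamondData d m ν)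
    (Ω : Set (Fin d → ℝ)) (p : (Fin d → ℝ) → ℝ) (n : Fin d → ℕ) : WGraph (NodeIn Ω n ν) :=
  (gridGraph S p n).induce fun v => immersion v ∈ Ω

/-- A regular domain: a Lebesgue measurable subset of the unit cube whose boundary has Lebesgue
measure zero. -/
structure IsRegularDomain {d : ℕ} (Ω : Set (Fin d → ℝ)) : Prop where
  subset_cube : Ω ⊆ Set.Icc 0 1
  nullMeasurable : NullMeasurableSet Ω
  frontier_null : volume (frontier Ω) = 0

/-- `∑ F(λ)` over the complex eigenvalues `λ` of `A`, counted with algebraic multiplicity. -/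
noncomputable def eigSum {V : Type*} [Fintype V] [DecidableEq V] (F : ℂ → ℂ)
    (A : Matrix V V ℂ) : ℂ :=
  (A.charpoly.roots.map F).sum

/-- The family of matrices `X j`, whose sizes tend to infinity along `l`, is distributed along `l`
like the Hermitian `ν × ν` matrix-valued function `g` on `D` in the sense of the eigenvalues:
`D` has positive finite measure, `g` is measurable and Hermitian on `D` and, for every continuous
compactly supported `F`, the mean of `F` over the eigenvalues of `X j` converges to the mean over
`D` of the mean of `F` over the `ν` eigenvalues of `g`. -/
structure EigDistributed {J : Type*} (l : Filter J) {V : J → Type*} [∀ j, Fintype (V j)]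
    [∀ j, DecidableEq (V j)] (X : ∀ j, Matrix (V j) (V j) ℂ)
    {Y : Type*} [MeasureSpace Y] (D : Set Y) {ν : ℕ} (g : Y → Matrix (Fin ν) (Fin ν) ℂ) :
    Prop where
  nullMeasurable : NullMeasurableSet D
  volume_pos : 0 < volume D
  volume_lt_top : volume D < ⊤
  measurable : ∀ r s, AEMeasurable (fun y => g y r s) (volume.restrict D)
  hermitian : ∀ y ∈ D, (g y).IsHermitian
  size_tendsto : Tendsto (fun j => Fintype.card (V j)) l atTop
  integrable : ∀ F : ℂ → ℂ, Continuous F → HasCompactSupport F →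
    IntegrableOn (fun y => eigSum F (g y)) D
  limit : ∀ F : ℂ → ℂ, Continuous F → HasCompactSupport F →
    Tendsto (fun j => (Fintype.card (V j) : ℂ)⁻¹ * eigSum F (X j)) l
      (𝓝 (((volume D).toReal : ℂ)⁻¹ * ∫ y in D, (ν : ℂ)⁻¹ * eigSum F (g y)))

end DiamondToeplitz

open DiamondToeplitz

namespace DiamondToeplitz

/-! ### Polynomial majorants and the moment method -/

/-! The proof is local: it never looks at the spectrum as a whole, but at the spectral measures of
the adjacency matrix `A` at the basis vectors. Their sum over all nodes is the eigenvalue counting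
measure, and the `k`-th moment at the node `u` is `(A ^ k) u u`, a weighted sum over closed walks of
length `k` through `u`.

Fix a point `x` in the interior of `Ω` at which `p` is continuous. A walk of length `k` from the
cell of `x` visits boundedly many lattice offsets, so as the mesh shrinks all its nodes lie in `Ω`
and all values of `p` on it tend to `p x`. The walks therefore become walks on the infinite periodic
lattice, which are counted by the Fourier coefficients of the powers of the symbol: the entries of
`A ^ k` satisfy the recursion `powExt_succ`, those coefficients satisfy `powCoeff_succ`, and the
first tends to the second, up to the factor `p x ^ k` (`tendsto_powExt`). So the moments summed over
one diamond tend to the mean over the torus of the trace of `(p x • f θ) ^ k`. The limit measure has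
compact support, and the moment method (`tendsto_sum_of_moments`) upgrades this to every bounded
continuous `F` (`tendsto_localEigSum`).

The sum over the cells, divided by their number, is the integral over the unit cube of a function
constant on cells. Dominated convergence gives the limit (`tendsto_inv_mul_eigSum`): points outside
the closure of `Ω` contribute nothing and the frontier is null. Only `F` has to be bounded, not `p`.
The choice `F = 1` counts the nodes, and the quotient of the two limits is the theorem. The
restriction to `[0, π]^d` is the change of variables `θ ↦ |θ|`. -/

theorem norm_polynomial_eval_le (P : Polynomial ℂ) {R : ℝ} (hR : 1 ≤ R) {N : ℕ}
    (hN : P.natDegree ≤ 2 * N) {x : ℝ} (hx : R ≤ |x|) :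
    ‖P.eval (x : ℂ)‖ ≤
      (∑ i ∈ Finset.range (P.natDegree + 1), ‖P.coeff i‖ * R ^ i) * (x / R) ^ (2 * N) := by
  have hR0 : 0 < R := by linarith
  have hy : 1 ≤ |x| / R := (one_le_div hR0).2 hx
  rw [Polynomial.eval_eq_sum_range, Finset.sum_mul]
  refine (norm_sum_le _ _).trans (Finset.sum_le_sum fun i hi => ?_)
  have hi' : i ≤ 2 * N := by
    have := Finset.mem_range.1 hi
    omega
  have e : (x / R) ^ (2 * N) = (|x| / R) ^ (2 * N) := by
    rw [pow_mul, pow_mul, div_pow x, div_pow |x|, sq_abs]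
  rw [norm_mul, norm_pow, Complex.norm_real, Real.norm_eq_abs, e, mul_assoc]
  refine mul_le_mul_of_nonneg_left ?_ (norm_nonneg _)
  calc |x| ^ i = R ^ i * (|x| / R) ^ i := by
        rw [← mul_pow]; congr 1; field_simp
    _ ≤ _ := mul_le_mul_of_nonneg_left (pow_le_pow_right₀ hy hi') (by positivity)

theorem exists_polynomial_near_complex {F : ℝ → ℂ} (hF : Continuous F) (R : ℝ) {ε : ℝ}
    (hε : 0 < ε) : ∃ P : Polynomial ℂ, ∀ x ∈ Set.Icc (-R) R, ‖F x - P.eval (x : ℂ)‖ ≤ ε := by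
  obtain ⟨p, hp⟩ := exists_polynomial_near_of_continuousOn (-R) R (fun x => (F x).re)
    (Complex.continuous_re.comp hF).continuousOn (ε / 2) (by positivity)
  obtain ⟨q, hq⟩ := exists_polynomial_near_of_continuousOn (-R) R (fun x => (F x).im)
    (Complex.continuous_im.comp hF).continuousOn (ε / 2) (by positivity)
  refine ⟨p.map Complex.ofRealHom + Polynomial.C Complex.I * q.map Complex.ofRealHom,
    fun x hx => ?_⟩
  have h1 := (hp x hx).le
  have h2 := (hq x hx).le
  have e1 : ∀ r : Polynomial ℝ,
      (r.map Complex.ofRealHom).eval (x : ℂ) = ((r.eval x : ℝ) : ℂ) := fun r =>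
    Polynomial.eval_map_apply (f := Complex.ofRealHom) (p := r) x
  refine (Complex.norm_le_abs_re_add_abs_im _).trans ?_
  rw [abs_sub_comm] at h1 h2
  simp only [Polynomial.eval_add, Polynomial.eval_mul, Polynomial.eval_C, e1, Complex.sub_re,
    Complex.sub_im, Complex.add_re, Complex.add_im, Complex.mul_re, Complex.mul_im,
    Complex.ofReal_re, Complex.ofReal_im, Complex.I_re, Complex.I_im]
  simp only [zero_mul, one_mul, mul_zero, add_zero, zero_add, sub_self]
  linarith

/-- A bounded continuous function is approximated on the whole line by a polynomial, up to an error
dominated by a polynomial that is small on a given interval. -/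
theorem exists_polynomial_majorant {F : ℝ → ℂ} (hF : Continuous F) {M : ℝ}
    (hM : ∀ x, ‖F x‖ ≤ M) (ρ : ℝ) {ε : ℝ} (hε : 0 < ε) :
    ∃ (P : Polynomial ℂ) (Q : Polynomial ℝ), (∀ x : ℝ, ‖F x - P.eval (x : ℂ)‖ ≤ Q.eval x) ∧
      ∀ x, |x| ≤ ρ → Q.eval x ≤ ε := by
  -- Since `|ρ| < R`, the even power `(x / R) ^ (2 * N)` is at least `1` outside `[-R, R]` and tends
  -- to `0` with `N` uniformly on `|x| ≤ ρ`. A multiple of it can thus absorb both `F` and `P` far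
  -- away and still be negligible near the support.
  set R : ℝ := |ρ| + 1 with hRdef
  have hR1 : 1 ≤ R := by simp [hRdef]
  have hR0 : 0 < R := by linarith
  obtain ⟨P, hP⟩ := exists_polynomial_near_complex hF R (half_pos hε)
  set K := ∑ i ∈ Finset.range (P.natDegree + 1), ‖P.coeff i‖ * R ^ i
  have hK : 0 ≤ K := Finset.sum_nonneg fun i _ => by positivity
  have hM0 : 0 ≤ M := (norm_nonneg _).trans (hM 0)
  have hq : (|ρ| / R) ^ 2 < 1 := by
    have : |ρ| / R < 1 := (div_lt_one hR0).2 (by simp [hRdef])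
    exact pow_lt_one₀ (by positivity) this two_ne_zero
  have ht : Tendsto (fun N : ℕ => (M + K) * ((|ρ| / R) ^ 2) ^ N) atTop (𝓝 0) := by
    simpa using (tendsto_pow_atTop_nhds_zero_of_lt_one (by positivity) hq).const_mul (M + K)
  obtain ⟨N, hN1, hN2⟩ := ((ht.eventually_le_const (half_pos hε)).and
    (eventually_ge_atTop P.natDegree)).exists
  refine ⟨P, Polynomial.C (ε / 2) + Polynomial.C ((M + K) / R ^ (2 * N)) * Polynomial.X ^ (2 * N),
    fun x => ?_, fun x hx => ?_⟩
  · have e : (Polynomial.C (ε / 2) +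
        Polynomial.C ((M + K) / R ^ (2 * N)) * Polynomial.X ^ (2 * N)).eval x
        = ε / 2 + (M + K) * (x / R) ^ (2 * N) := by
      simp only [Polynomial.eval_add, Polynomial.eval_mul, Polynomial.eval_C, Polynomial.eval_pow,
        Polynomial.eval_X, div_pow]
      ring
    have hpos : 0 ≤ (x / R) ^ (2 * N) := by rw [pow_mul]; positivity
    rw [e]
    rcases le_total |x| R with h | h
    · have := hP x (abs_le.1 h)
      have := mul_nonneg (add_nonneg hM0 hK) hpos
      linarith
    · have h1 := norm_polynomial_eval_le P hR1 (N := N) (by omega) h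
      have h2 : 1 ≤ (x / R) ^ (2 * N) := by
        rw [pow_mul, div_pow, ← sq_abs x, ← div_pow]
        exact one_le_pow₀ (one_le_pow₀ ((one_le_div hR0).2 h))
      have h3 : M * 1 ≤ M * (x / R) ^ (2 * N) := mul_le_mul_of_nonneg_left h2 hM0
      have h4 := norm_sub_le (F x) (P.eval (x : ℂ))
      have h5 := hM x
      rw [add_mul]
      linarith
  · have e : (Polynomial.C (ε / 2) +
        Polynomial.C ((M + K) / R ^ (2 * N)) * Polynomial.X ^ (2 * N)).eval x
        = ε / 2 + (M + K) * ((|x| / R) ^ 2) ^ N := by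
      simp only [Polynomial.eval_add, Polynomial.eval_mul, Polynomial.eval_C, Polynomial.eval_pow,
        Polynomial.eval_X, div_pow, sq_abs, ← pow_mul]
      ring
    rw [e]
    have h1 : (|x| / R) ^ 2 ≤ (|ρ| / R) ^ 2 := by
      have := hx.trans (le_abs_self ρ)
      gcongr
    have h2 : ((|x| / R) ^ 2) ^ N ≤ ((|ρ| / R) ^ 2) ^ N := pow_le_pow_left₀ (by positivity) h1 N
    have := mul_le_mul_of_nonneg_left h2 (add_nonneg hM0 hK)
    linarith

section Moments

variable {ι Θ κ : Type*} {l : Filter ι} {J : ι → Type*} [∀ n, Fintype (J n)]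
  {w lam : ∀ n, J n → ℝ} [MeasurableSpace Θ] {μ : Measure Θ} [Fintype κ] {e : Θ → κ → ℝ}

theorem tendsto_sum_polynomial_of_moments
    (hint : ∀ G : ℝ → ℂ, Continuous G → Integrable (fun θ => ∑ s, G (e θ s)) μ)
    (hmom : ∀ k : ℕ, Tendsto (fun n => ∑ j, (w n j : ℂ) * (lam n j : ℂ) ^ k) l
      (𝓝 (∫ θ, ∑ s, (e θ s : ℂ) ^ k ∂μ))) (P : Polynomial ℂ) :
    Tendsto (fun n => ∑ j, (w n j : ℂ) * P.eval (lam n j : ℂ)) l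
      (𝓝 (∫ θ, ∑ s, P.eval (e θ s : ℂ) ∂μ)) := by
  have hc : ∀ P : Polynomial ℂ, Continuous fun x : ℝ => P.eval (x : ℂ) := fun P =>
    P.continuous.comp Complex.continuous_ofReal
  induction P using Polynomial.induction_on' with
  | add p q hp hq =>
    simp only [Polynomial.eval_add, mul_add, Finset.sum_add_distrib]
    rw [integral_add (hint _ (hc p)) (hint _ (hc q))]
    exact hp.add hq
  | monomial k a =>
    simp only [Polynomial.eval_monomial, mul_left_comm _ a, ← Finset.mul_sum]
    rw [integral_const_mul]
    exact (hmom k).const_mul a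

/-- The moment method: convergence of the moments of discrete measures to those of a compactly
supported one implies convergence of the integrals of bounded continuous functions. -/
theorem tendsto_sum_of_moments [IsFiniteMeasure μ] (hw : ∀ n j, 0 ≤ w n j) {ρ : ℝ}
    (he : ∀ᵐ θ ∂μ, ∀ s, |e θ s| ≤ ρ)
    (hint : ∀ G : ℝ → ℂ, Continuous G → Integrable (fun θ => ∑ s, G (e θ s)) μ)
    (hmom : ∀ k : ℕ, Tendsto (fun n => ∑ j, (w n j : ℂ) * (lam n j : ℂ) ^ k) l
      (𝓝 (∫ θ, ∑ s, (e θ s : ℂ) ^ k ∂μ)))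
    {F : ℝ → ℂ} (hF : Continuous F) {M : ℝ} (hM : ∀ x, ‖F x‖ ≤ M) :
    Tendsto (fun n => ∑ j, (w n j : ℂ) * F (lam n j)) l (𝓝 (∫ θ, ∑ s, F (e θ s) ∂μ)) := by
  rw [Metric.tendsto_nhds]
  intro ε hε
  set K : ℝ := Fintype.card κ * μ.real Set.univ
  have hK : 0 ≤ K := by positivity
  -- Three errors are added at the end: `δ * K + δ` for replacing `F` by `P` in the discrete sums,
  -- `δ` for the convergence of the sums of `P`, and `δ * K` for returning to `F` in the limit.
  -- Their total `δ * (2 * K + 2)` is less than `ε`.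
  obtain ⟨P, Q, hPQ, hQ⟩ := exists_polynomial_majorant hF hM ρ
    (ε := ε / (2 * K + 3)) (by positivity)
  set δ := ε / (2 * K + 3)
  have hδ : 0 < δ := by positivity
  have hδε : δ * (2 * K + 3) = ε := by simp only [δ]; field_simp
  have hc : Continuous fun x : ℝ => P.eval (x : ℂ) := P.continuous.comp Complex.continuous_ofReal
  have e1 : ∀ x : ℝ, (Q.map Complex.ofRealHom).eval (x : ℂ) = ((Q.eval x : ℝ) : ℂ) := fun x =>
    Polynomial.eval_map_apply (f := Complex.ofRealHom) (p := Q) x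
  have hQ0 : ∀ x, 0 ≤ Q.eval x := fun x => (norm_nonneg _).trans (hPQ x)
  have t1 := tendsto_sum_polynomial_of_moments hint hmom P
  -- The majorant is itself a polynomial, so its discrete sums converge too. This controls the mass
  -- far from `[-ρ, ρ]`, although no bound on the points `lam n j` is available.
  have t2 := (tendsto_sum_polynomial_of_moments hint hmom (Q.map Complex.ofRealHom)).norm
  have b2 : ‖∫ θ, ∑ s, (Q.map Complex.ofRealHom).eval (e θ s : ℂ) ∂μ‖ ≤ δ * K := by
    refine (norm_integral_le_of_norm_le_const (C := Fintype.card κ * δ) ?_).trans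
      (le_of_eq (by ring))
    filter_upwards [he] with θ hθ
    refine (norm_sum_le _ _).trans ?_
    rw [← nsmul_eq_mul, ← Finset.card_univ]
    refine Finset.sum_le_card_nsmul _ _ _ fun s _ => ?_
    rw [e1, Complex.norm_real, Real.norm_of_nonneg (hQ0 _)]
    exact hQ _ (hθ s)
  have b3 : ‖∫ θ, ∑ s, F (e θ s) ∂μ - ∫ θ, ∑ s, P.eval (e θ s : ℂ) ∂μ‖ ≤ δ * K := by
    rw [← integral_sub (hint F hF) (hint _ hc)]
    refine (norm_integral_le_of_norm_le_const (C := Fintype.card κ * δ) ?_).trans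
      (le_of_eq (by ring))
    filter_upwards [he] with θ hθ
    rw [← Finset.sum_sub_distrib]
    refine (norm_sum_le _ _).trans ?_
    rw [← nsmul_eq_mul, ← Finset.card_univ]
    exact Finset.sum_le_card_nsmul _ _ _ fun s _ => (hPQ _).trans (hQ _ (hθ s))
  filter_upwards [Metric.tendsto_nhds.1 t1 δ hδ,
    t2.eventually_le_const (u := δ * K + δ) (by linarith)] with n h1 h2
  have b1 : ‖∑ j, (w n j : ℂ) * F (lam n j) - ∑ j, (w n j : ℂ) * P.eval (lam n j : ℂ)‖
      ≤ δ * K + δ := by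
    refine le_trans ?_ h2
    rw [← Finset.sum_sub_distrib]
    have e2 : ∑ j, (w n j : ℂ) * (Q.map Complex.ofRealHom).eval (lam n j : ℂ)
        = ((∑ j, w n j * Q.eval (lam n j) : ℝ) : ℂ) := by
      push_cast
      simp only [e1]
    rw [e2, Complex.norm_real, Real.norm_of_nonneg
      (Finset.sum_nonneg fun j _ => mul_nonneg (hw n j) (hQ0 _))]
    refine (norm_sum_le _ _).trans (Finset.sum_le_sum fun j _ => ?_)
    rw [← mul_sub, norm_mul, Complex.norm_real, Real.norm_of_nonneg (hw n j)]
    exact mul_le_mul_of_nonneg_left (hPQ _) (hw n j)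
  rw [dist_eq_norm] at h1 ⊢
  have tri := norm_add_le_of_le (norm_add_le_of_le b1 h1.le) ((norm_sub_rev _ _).trans_le b3)
  have e3 : ∀ a b c d : ℂ, (a - b) + (b - c) + (c - d) = a - d := fun _ _ _ _ => by ring
  rw [e3] at tri
  linarith

end Moments

/-! ### Eigenvalue sums of Hermitian matrices -/

section Hermitian

variable {V : Type*} [Fintype V] [DecidableEq V] {A : Matrix V V ℂ}

theorem eigSum_eq_sum_eigenvalues (hA : A.IsHermitian) (F : ℂ → ℂ) :
    eigSum F A = ∑ j, F (hA.eigenvalues j) := by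
  rw [eigSum, hA.roots_charpoly_eq_eigenvalues, Multiset.map_map]
  rfl

/-- The mass at the `j`-th eigenvalue of the spectral measure of `A` at the `u`-th basis vector. -/
noncomputable def spectralWeight (hA : A.IsHermitian) (u j : V) : ℝ :=
  ‖(hA.eigenvectorUnitary : Matrix V V ℂ) u j‖ ^ 2

theorem spectralWeight_nonneg (hA : A.IsHermitian) (u j : V) : 0 ≤ spectralWeight hA u j :=
  sq_nonneg _

/-- Diagonalization by the eigenvector matrix, read at the entry `(u, u)`: the moments of the
spectral measure at `u` are diagonal entries of powers. -/
theorem pow_apply_self_eq_sum (hA : A.IsHermitian) (k : ℕ) (u : V) :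
    (A ^ k) u u = ∑ j, (spectralWeight hA u j : ℂ) * (hA.eigenvalues j : ℂ) ^ k := by
  have h := congrArg (· ^ k) hA.spectral_theorem
  simp only [← map_pow, Matrix.diagonal_pow] at h
  rw [h, Unitary.conjStarAlgAut_apply, Matrix.mul_apply]
  refine Finset.sum_congr rfl fun j _ => ?_
  rw [Matrix.mul_diagonal, Matrix.star_apply, spectralWeight, Complex.ofReal_pow,
    ← Complex.mul_conj']
  simp only [Pi.pow_apply, Function.comp, Complex.star_def]
  change _ * (hA.eigenvalues j : ℂ) ^ k * _ = _
  ring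

theorem sum_spectralWeight_right (hA : A.IsHermitian) (u : V) :
    ∑ j, spectralWeight hA u j = 1 := by
  have h := pow_apply_self_eq_sum hA 0 u
  simp only [pow_zero, Matrix.one_apply_eq, mul_one] at h
  exact_mod_cast h.symm

/-- The columns of the eigenvector matrix are unit vectors. Hence the spectral measures at all basis
vectors add up to the eigenvalue counting measure. -/
theorem sum_spectralWeight_left (hA : A.IsHermitian) (j : V) :
    ∑ u, spectralWeight hA u j = 1 := by
  have h := congrFun (congrFun (Unitary.coe_star_mul_self hA.eigenvectorUnitary) j) j
  rw [Matrix.mul_apply, Matrix.one_apply_eq] at h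
  have h2 : ((∑ u, spectralWeight hA u j : ℝ) : ℂ) = 1 := by
    rw [← h]
    push_cast [spectralWeight]
    refine Finset.sum_congr rfl fun u _ => ?_
    rw [← Complex.conj_mul', Matrix.star_apply]
    rfl
  exact_mod_cast h2

theorem trace_pow_eq_sum (hA : A.IsHermitian) (k : ℕ) :
    (A ^ k).trace = ∑ j, (hA.eigenvalues j : ℂ) ^ k := by
  simp only [Matrix.trace, Matrix.diag, pow_apply_self_eq_sum hA]
  rw [Finset.sum_comm]
  refine Finset.sum_congr rfl fun j _ => ?_
  rw [← Finset.sum_mul, ← Complex.ofReal_sum, sum_spectralWeight_left, Complex.ofReal_one, one_mul]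

theorem sum_polynomial_eigenvalues (hA : A.IsHermitian) (P : Polynomial ℂ) :
    ∑ j, P.eval (hA.eigenvalues j : ℂ) =
      ∑ i ∈ Finset.range (P.natDegree + 1), P.coeff i * (A ^ i).trace := by
  simp only [Polynomial.eval_eq_sum_range, trace_pow_eq_sum hA, Finset.mul_sum]
  exact Finset.sum_comm

/-- The trace of the square is the sum of the squared eigenvalues and is visibly continuous in the
entries. The bound `C + 1` merely avoids the square root of `C`. -/
theorem abs_eigenvalue_le (hA : A.IsHermitian) {C : ℝ} (hC : ‖(A ^ 2).trace‖ ≤ C) (j : V) :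
    |hA.eigenvalues j| ≤ C + 1 := by
  rw [trace_pow_eq_sum hA] at hC
  have e : ∑ j, (hA.eigenvalues j : ℂ) ^ 2 = ((∑ j, hA.eigenvalues j ^ 2 : ℝ) : ℂ) := by
    push_cast; rfl
  rw [e, Complex.norm_real, Real.norm_of_nonneg (Finset.sum_nonneg fun j _ => sq_nonneg _)] at hC
  have h1 := (Finset.single_le_sum (fun j _ => sq_nonneg (hA.eigenvalues j))
    (Finset.mem_univ j)).trans hC
  exact abs_le_of_sq_le_sq (by nlinarith) (by nlinarith [sq_nonneg (hA.eigenvalues j)])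

end Hermitian

/-! ### Measurability of eigenvalue sums of matrix-valued functions -/

section Measurability

variable {V Y : Type*} [Fintype V] [DecidableEq V] [MeasurableSpace Y] {μ : Measure Y}
  {A : Y → Matrix V V ℂ}

theorem aemeasurable_pow_apply (hm : ∀ r s, AEMeasurable (fun y => A y r s) μ) (k : ℕ) (r s : V) :
    AEMeasurable (fun y => (A y ^ k) r s) μ := by
  induction k generalizing r s with
  | zero => simp only [pow_zero]; exact aemeasurable_const
  | succ k ih =>
    simp only [pow_succ, Matrix.mul_apply]
    exact Finset.aemeasurable_fun_sum _ fun t _ => (ih r t).mul (hm t s)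

/-- Measurability of the individual eigenvalues is bypassed. For a polynomial the sum is a
combination of traces of powers, and `G` is a pointwise limit of polynomials, the `i`-th of which is
within `1 / (i + 1)` of `G` on `[-i, i]`. -/
theorem aestronglyMeasurable_sum_eigenvalues (hA : ∀ y, (A y).IsHermitian)
    (hm : ∀ r s, AEMeasurable (fun y => A y r s) μ) {G : ℝ → ℂ} (hG : Continuous G) :
    AEStronglyMeasurable (fun y => ∑ j, G ((hA y).eigenvalues j)) μ := by
  choose P hP using fun i : ℕ =>
    exists_polynomial_near_complex hG i (ε := 1 / ((i : ℝ) + 1)) (by positivity)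
  refine aestronglyMeasurable_of_tendsto_ae atTop
    (f := fun i y => ∑ j, (P i).eval ((hA y).eigenvalues j : ℂ)) (fun i => ?_)
    (Eventually.of_forall fun y => ?_)
  · simp only [sum_polynomial_eigenvalues]
    refine AEMeasurable.aestronglyMeasurable ?_
    refine Finset.aemeasurable_fun_sum _ fun k _ => AEMeasurable.const_mul ?_ _
    exact Finset.aemeasurable_fun_sum _ fun r _ => aemeasurable_pow_apply hm k r r
  · refine tendsto_finsetSum _ fun j _ => ?_
    rw [tendsto_iff_norm_sub_tendsto_zero]
    refine squeeze_zero' (Eventually.of_forall fun _ => norm_nonneg _) ?_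
      (tendsto_one_div_add_atTop_nhds_zero_nat (𝕜 := ℝ))
    filter_upwards [eventually_ge_atTop ⌈|(hA y).eigenvalues j|⌉₊] with i hi
    rw [norm_sub_rev]
    exact hP i _ (abs_le.1 ((Nat.le_ceil _).trans (by exact_mod_cast hi)))

end Measurability

end DiamondToeplitz

namespace DiamondToeplitz

/-! ### The uniform probability measure on a cube -/

/-- The uniform probability measure on the interval `[a, b]`. -/
noncomputable def uniformIcc (a b : ℝ) : Measure ℝ :=
  (ENNReal.ofReal (b - a))⁻¹ • volume.restrict (Set.Icc a b)

/-- The uniform probability measure on the cube `[a, b]^d`. -/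
noncomputable def uniformCube (d : ℕ) (a b : ℝ) : Measure (Fin d → ℝ) :=
  Measure.pi fun _ => uniformIcc a b

theorem isProbabilityMeasure_uniformIcc {a b : ℝ} (h : a < b) :
    IsProbabilityMeasure (uniformIcc a b) := by
  constructor
  rw [uniformIcc, Measure.smul_apply, Measure.restrict_apply_univ, Real.volume_Icc, smul_eq_mul]
  exact ENNReal.inv_mul_cancel (by simpa using h) ENNReal.ofReal_ne_top

instance (a b : ℝ) : SFinite (uniformIcc a b) := by
  unfold uniformIcc; infer_instance

theorem isProbabilityMeasure_uniformCube (d : ℕ) {a b : ℝ} (h : a < b) :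
    IsProbabilityMeasure (uniformCube d a b) := by
  have := isProbabilityMeasure_uniformIcc h
  unfold uniformCube; infer_instance

theorem uniformCube_eq_smul (d : ℕ) {a b : ℝ} (h : a < b) :
    uniformCube d a b =
      ((ENNReal.ofReal (b - a))⁻¹ ^ d) • volume.restrict (Set.Icc (fun _ : Fin d => a) fun _ => b) := by
  have := isProbabilityMeasure_uniformIcc h
  refine Measure.pi_eq fun s _ => ?_
  rw [← Set.pi_univ_Icc, volume_pi, Measure.restrict_pi_pi, Measure.smul_apply, Measure.pi_pi]
  simp only [uniformIcc, Measure.smul_apply, smul_eq_mul, Finset.prod_mul_distrib,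
    Finset.prod_const, Finset.card_univ, Fintype.card_fin]

theorem integrable_uniformCube_of_continuous {d : ℕ} {a b : ℝ} (h : a < b)
    {g : (Fin d → ℝ) → ℂ} (hg : Continuous g) : Integrable g (uniformCube d a b) := by
  rw [uniformCube_eq_smul d h]
  refine Integrable.smul_measure hg.integrableOn_Icc ?_
  exact ENNReal.pow_ne_top (ENNReal.inv_ne_top.2 (by simpa using h))

theorem ae_mem_Icc_uniformCube {d : ℕ} {a b : ℝ} (h : a < b) :
    ∀ᵐ θ ∂(uniformCube d a b), θ ∈ Set.Icc (fun _ : Fin d => a) fun _ => b := by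
  rw [uniformCube_eq_smul d h]
  exact Measure.ae_smul_measure (ae_restrict_mem measurableSet_Icc) _

theorem integral_uniformCube_eq {d : ℕ} {a b : ℝ} (h : a < b) (g : (Fin d → ℝ) → ℂ) :
    ∫ θ, g θ ∂(uniformCube d a b) =
      ((volume (Set.Icc (fun _ : Fin d => a) fun _ => b)).toReal : ℂ)⁻¹ *
        ∫ θ in Set.Icc (fun _ : Fin d => a) fun _ => b, g θ := by
  rw [uniformCube_eq_smul d h, integral_smul_measure, Real.volume_Icc_pi]
  simp only [Finset.prod_const, Finset.card_univ, Fintype.card_fin, ENNReal.toReal_pow,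
    ENNReal.toReal_inv, Complex.real_smul]
  push_cast
  rw [inv_pow]

/-- The character `θ ↦ exp (i δ·θ)` of the torus. -/
noncomputable def torusChar {d : ℕ} (δ : Fin d → ℤ) (θ : Fin d → ℝ) : ℂ :=
  ∏ q, Complex.exp (((δ q : ℂ) * Complex.I) * (θ q : ℂ))

theorem continuous_torusChar {d : ℕ} (δ : Fin d → ℤ) : Continuous (torusChar δ) := by
  unfold torusChar; fun_prop

theorem torusChar_eq_exp {d : ℕ} (δ : Fin d → ℤ) (θ : Fin d → ℝ) :
    torusChar δ θ = Complex.exp (((∑ q, (δ q : ℝ) * θ q : ℝ) : ℂ) * Complex.I) := by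
  rw [torusChar, ← Complex.exp_sum]
  congr 1
  push_cast
  rw [Finset.sum_mul]
  exact Finset.sum_congr rfl fun q _ => by ring

theorem torusChar_add {d : ℕ} (δ ε : Fin d → ℤ) (θ : Fin d → ℝ) :
    torusChar (δ + ε) θ = torusChar δ θ * torusChar ε θ := by
  rw [torusChar, torusChar, torusChar, ← Finset.prod_mul_distrib]
  refine Finset.prod_congr rfl fun q _ => ?_
  rw [← Complex.exp_add]
  congr 1
  push_cast [Pi.add_apply]
  ring

theorem torusChar_zero {d : ℕ} (θ : Fin d → ℝ) : torusChar 0 θ = 1 := by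
  simp [torusChar]

theorem integral_uniformIcc_exp (k : ℤ) :
    ∫ x, Complex.exp (((k : ℂ) * Complex.I) * (x : ℂ)) ∂(uniformIcc (-Real.pi) Real.pi) =
      if k = 0 then 1 else 0 := by
  split_ifs with hk
  · have := isProbabilityMeasure_uniformIcc (neg_lt_self Real.pi_pos)
    simp [hk]
  · have hc : (k : ℂ) * Complex.I ≠ 0 := mul_ne_zero (by exact_mod_cast hk) Complex.I_ne_zero
    rw [uniformIcc, integral_smul_measure, integral_Icc_eq_integral_Ioc,
      ← intervalIntegral.integral_of_le (by linarith [Real.pi_pos]), integral_exp_mul_complex hc]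
    have : Complex.exp ((k : ℂ) * Complex.I * (Real.pi : ℝ)) =
        Complex.exp ((k : ℂ) * Complex.I * ((-Real.pi : ℝ) : ℂ)) := by
      rw [Complex.exp_eq_exp_iff_exists_int]
      exact ⟨k, by push_cast; ring⟩
    rw [this]
    simp

theorem integral_torusChar {d : ℕ} (δ : Fin d → ℤ) :
    ∫ θ, torusChar δ θ ∂(uniformCube d (-Real.pi) Real.pi) = if δ = 0 then 1 else 0 := by
  have := isProbabilityMeasure_uniformIcc (neg_lt_self Real.pi_pos)
  unfold torusChar uniformCube
  rw [integral_fintype_prod_eq_prod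
    (f := fun q (x : ℝ) => Complex.exp (((δ q : ℂ) * Complex.I) * (x : ℂ)))]
  simp only [integral_uniformIcc_exp]
  split_ifs with h
  · simp [h]
  · obtain ⟨q, hq⟩ := Function.ne_iff.1 h
    exact Finset.prod_eq_zero (Finset.mem_univ q) (if_neg hq)

/-! ### The symbol and the Fourier coefficients of its powers -/

namespace DiamondData

variable {d m ν : ℕ}

/-- All blocks `𝐰_δ`, including the mold graph on the diagonal. -/
def fullBlock (S : DiamondData d m ν) (δ : Fin d → ℤ) : Matrix (Fin ν) (Fin ν) ℝ :=
  (if δ = 0 then S.mold.adjMatrix else 0) + S.block δ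

/-- A finite set of multi-indices outside which the blocks vanish. -/
def stencil (S : DiamondData d m ν) : Finset (Fin d → ℤ) :=
  insert 0 (Finset.univ.biUnion fun k =>
    directions (S.t k) ∪ (directions (S.t k)).image fun α => -α)

theorem zero_mem_stencil (S : DiamondData d m ν) : 0 ∈ S.stencil :=
  Finset.mem_insert_self _ _

theorem block_zero (S : DiamondData d m ν) : S.block 0 = 0 := by
  refine S.block_eq_zero 0 fun k α => ?_
  have h0 : (α : Fin d → ℤ) ≠ 0 := by
    obtain ⟨-, r, hr, -⟩ := mem_directions.1 α.2
    intro h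
    rw [h] at hr
    exact lt_irrefl _ hr
  exact ⟨h0.symm, fun h => h0 (neg_eq_zero.1 h.symm)⟩

theorem coe_mem_stencil (S : DiamondData d m ν) {k : Fin m} (α : directions (S.t k)) :
    (α : Fin d → ℤ) ∈ S.stencil :=
  Finset.mem_insert_of_mem (Finset.mem_biUnion.2
    ⟨k, Finset.mem_univ k, Finset.mem_union_left _ α.2⟩)

theorem neg_coe_mem_stencil (S : DiamondData d m ν) {k : Fin m} (α : directions (S.t k)) :
    -(α : Fin d → ℤ) ∈ S.stencil :=
  Finset.mem_insert_of_mem (Finset.mem_biUnion.2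
    ⟨k, Finset.mem_univ k, Finset.mem_union_right _ (Finset.mem_image_of_mem _ α.2)⟩)

theorem fullBlock_eq_zero (S : DiamondData d m ν) {δ : Fin d → ℤ} (h : δ ∉ S.stencil) :
    S.fullBlock δ = 0 := by
  rw [fullBlock, if_neg, S.block_eq_zero, add_zero]
  · exact fun k α => ⟨fun e => h (e ▸ S.coe_mem_stencil α), fun e => h (e ▸ S.neg_coe_mem_stencil α)⟩
  · exact fun e => h (e ▸ S.zero_mem_stencil)

/-- No direction is zero, so the mold and the linking blocks merge into one translation-invariant
kernel without a case distinction. -/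
theorem graph_w_eq (S : DiamondData d m ν) {n : Fin d → ℕ} (u v : Node n ν) :
    (S.graph n).w u v = S.fullBlock (idxDiff u.1 v.1) u.2 v.2 := by
  have h : idxDiff u.1 v.1 = 0 ↔ u.1 = v.1 := by
    refine ⟨fun h => funext fun q => Fin.ext ?_, fun h => ?_⟩
    · have := congrFun h q
      simp only [idxDiff, Pi.zero_apply] at this
      omega
    · funext q
      simp [idxDiff, h]
  by_cases e : u.1 = v.1
  · rw [fullBlock, h.2 e, if_pos rfl, block_zero, add_zero]
    simp [graph, e, WGraph.adjMatrix]
  · rw [fullBlock, if_neg (mt h.1 e), zero_add]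
    simp [graph, e]

/-- Euler's formula turns `L e^{iα·θ} + Lᵀ e^{-iα·θ}` into the cosine and sine terms, so the blocks
are the Fourier coefficients of the symbol. -/
theorem symbol_eq_sum (S : DiamondData d m ν) (θ : Fin d → ℝ) :
    S.symbol θ = ∑ β ∈ S.stencil, torusChar β θ • (S.fullBlock β).map Complex.ofReal := by
  ext r s
  simp only [symbol, fullBlock, block, Matrix.add_apply, Matrix.sum_apply, Matrix.smul_apply,
    Matrix.map_apply, Matrix.sub_apply, Complex.ofReal_add, Complex.ofReal_sum, smul_add,
    Finset.sum_add_distrib]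
  congr 1
  · rw [Finset.sum_eq_single_of_mem 0 S.zero_mem_stencil]
    · simp [torusChar_zero]
    · intro β _ hβ
      simp [hβ]
  · rw [← Finset.sum_add_distrib, ← Finset.sum_add_distrib]
    simp only [Finset.smul_sum, ← Finset.sum_add_distrib]
    rw [Finset.sum_comm]
    refine Finset.sum_congr rfl fun k _ => ?_
    rw [Finset.sum_comm]
    refine Finset.sum_congr rfl fun α _ => ?_
    rw [Finset.sum_add_distrib, Finset.sum_eq_single_of_mem (α : Fin d → ℤ) (S.coe_mem_stencil α),
      Finset.sum_eq_single_of_mem (-(α : Fin d → ℤ)) (S.neg_coe_mem_stencil α)]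
    · rw [if_pos rfl, if_pos rfl, torusChar_eq_exp, torusChar_eq_exp]
      have e : (∑ q, (((-(α : Fin d → ℤ)) q : ℤ) : ℝ) * θ q)
          = -∑ q, ((α : Fin d → ℤ) q : ℝ) * θ q := by simp
      rw [e]
      set x := ∑ q, ((α : Fin d → ℤ) q : ℝ) * θ q
      simp only [Complex.exp_mul_I, Complex.ofReal_neg, Complex.cos_neg, Complex.sin_neg,
        Matrix.transpose_apply, smul_eq_mul, Complex.ofReal_sub, Complex.ofReal_cos,
        Complex.ofReal_sin]
      ring
    · intro β _ hβ
      simp [hβ]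
    · intro β _ hβ
      simp [hβ]

theorem continuous_symbol_apply (S : DiamondData d m ν) (r s : Fin ν) :
    Continuous fun θ => S.symbol θ r s := by
  simp only [symbol_eq_sum, Matrix.sum_apply, Matrix.smul_apply]
  exact continuous_finsetSum _ fun β _ => (continuous_torusChar β).smul continuous_const

theorem continuous_symbol_pow_apply (S : DiamondData d m ν) (k : ℕ) (r s : Fin ν) :
    Continuous fun θ => (S.symbol θ ^ k) r s := by
  have h : Continuous S.symbol := continuous_matrix S.continuous_symbol_apply
  exact (h.pow k).matrix_elem r s

theorem symbol_isHermitian (S : DiamondData d m ν) (θ : Fin d → ℝ) : (S.symbol θ).IsHermitian := by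
  ext r s
  simp only [symbol, Matrix.conjTranspose_apply, Matrix.add_apply, Matrix.sum_apply,
    Matrix.smul_apply, Matrix.map_apply, Matrix.sub_apply, Matrix.transpose_apply, star_add,
    star_sum, smul_eq_mul, Complex.star_def, map_mul, Complex.conj_ofReal, Complex.conj_I,
    WGraph.adjMatrix, Matrix.of_apply]
  rw [S.mold.symm s r]
  congr 1
  refine Finset.sum_congr rfl fun k _ => Finset.sum_congr rfl fun α _ => ?_
  push_cast
  ring

theorem symbol_neg (S : DiamondData d m ν) (θ : Fin d → ℝ) :
    S.symbol (-θ) = (S.symbol θ).transpose := by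
  ext r s
  simp only [symbol, Matrix.add_apply, Matrix.sum_apply,
    Matrix.smul_apply, Matrix.map_apply, Matrix.sub_apply, Matrix.transpose_apply, smul_eq_mul,
    WGraph.adjMatrix, Matrix.of_apply, Pi.neg_apply, mul_neg, Finset.sum_neg_distrib, Real.cos_neg,
    Real.sin_neg]
  rw [S.mold.symm s r]
  congr 1
  refine Finset.sum_congr rfl fun k _ => Finset.sum_congr rfl fun α _ => ?_
  push_cast
  ring

/-- The Fourier coefficients of the `k`-th power of the symbol. -/
noncomputable def powCoeff (S : DiamondData d m ν) (k : ℕ) (δ : Fin d → ℤ) (r s : Fin ν) : ℂ :=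
  ∫ θ, torusChar (-δ) θ * (S.symbol θ ^ k) r s ∂(uniformCube d (-Real.pi) Real.pi)

theorem powCoeff_zero (S : DiamondData d m ν) (δ : Fin d → ℤ) (r s : Fin ν) :
    S.powCoeff 0 δ r s = if δ = 0 ∧ r = s then 1 else 0 := by
  simp only [powCoeff, pow_zero]
  rw [integral_mul_const, integral_torusChar]
  by_cases h : δ = 0 <;> by_cases h' : r = s <;> simp [h, h', Matrix.one_apply]

/-- Multiplication by the symbol is convolution of Fourier coefficients with the blocks. This is the
recursion for walks on the infinite lattice, the counterpart of `powExt_succ`. -/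
theorem powCoeff_succ (S : DiamondData d m ν) (k : ℕ) (δ : Fin d → ℤ) (r s : Fin ν) :
    S.powCoeff (k + 1) δ r s =
      ∑ β ∈ S.stencil, ∑ r', (S.fullBlock β r r' : ℂ) * S.powCoeff k (δ - β) r' s := by
  simp only [powCoeff, ← integral_const_mul]
  have hi : ∀ β r', Integrable (fun θ => (S.fullBlock β r r' : ℂ) *
      (torusChar (-(δ - β)) θ * (S.symbol θ ^ k) r' s)) (uniformCube d (-Real.pi) Real.pi) :=
    fun β r' => integrable_uniformCube_of_continuous (neg_lt_self Real.pi_pos)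
      (continuous_const.mul ((continuous_torusChar _).mul (S.continuous_symbol_pow_apply k r' s)))
  simp only [← integral_finsetSum _ fun r' (_ : r' ∈ Finset.univ) => hi _ r']
  rw [← integral_finsetSum _ fun β _ => integrable_finsetSum _ fun r' _ => hi β r']
  refine integral_congr_ae (Eventually.of_forall fun θ => ?_)
  simp only [pow_succ', Matrix.mul_apply]
  nth_rewrite 1 [symbol_eq_sum]
  simp only [Matrix.sum_apply, Matrix.smul_apply, Matrix.map_apply, Finset.sum_mul, Finset.mul_sum]
  rw [Finset.sum_comm]
  refine Finset.sum_congr rfl fun β _ => Finset.sum_congr rfl fun r' _ => ?_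
  rw [neg_sub, sub_eq_neg_add, torusChar_add, smul_eq_mul]
  ring

theorem integral_trace_symbol_pow (S : DiamondData d m ν) (k : ℕ) :
    ∫ θ, (S.symbol θ ^ k).trace ∂(uniformCube d (-Real.pi) Real.pi) = ∑ r, S.powCoeff k 0 r r := by
  simp only [Matrix.trace, Matrix.diag, powCoeff, neg_zero, torusChar_zero, one_mul]
  exact integral_finsetSum _ fun r _ => integrable_uniformCube_of_continuous
    (neg_lt_self Real.pi_pos) (S.continuous_symbol_pow_apply k r r)

end DiamondData

end DiamondToeplitz

namespace DiamondToeplitz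

/-! ### Local convergence of the powers of the adjacency matrices -/

/-- The multi-index of the cell containing `x`. -/
noncomputable def cellIdx {d : ℕ} (n : Fin d → ℕ) (x : Fin d → ℝ) : Fin d → ℤ := fun q => ⌊(n q : ℝ) * x q⌋

theorem tendsto_eval_atTop {d : ℕ} (q : Fin d) :
    Tendsto (fun n : Fin d → ℕ => (n q : ℝ)) atTop atTop :=
  tendsto_natCast_atTop_atTop.comp
    (tendsto_atTop.2 fun b => (eventually_ge_atTop (fun _ => b)).mono fun _ hn => hn q)

theorem tendsto_div_of_abs_sub_le {ι : Type*} {l : Filter ι} {f g : ι → ℝ} (hg : Tendsto g l atTop)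
    {x C : ℝ} (h : ∀ i, |f i - x * g i| ≤ C) : Tendsto (fun i => f i / g i) l (𝓝 x) := by
  rw [tendsto_iff_norm_sub_tendsto_zero]
  refine squeeze_zero' (Eventually.of_forall fun _ => norm_nonneg _) ?_ (hg.const_div_atTop C)
  filter_upwards [hg.eventually_gt_atTop 0] with i hi
  have e : f i / g i - x = (f i - x * g i) / g i := by field_simp
  rw [e, Real.norm_eq_abs, abs_div, abs_of_pos hi]
  exact div_le_div_of_nonneg_right (h i) hi.le

theorem eventually_cellIdx_mem {d : ℕ} {x : Fin d → ℝ} (hx : ∀ q, x q ∈ Set.Ioo 0 1) (δ : Fin d → ℤ) :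
    ∀ᶠ n : Fin d → ℕ in atTop, ∀ q, 0 ≤ (cellIdx n x + δ) q ∧ (cellIdx n x + δ) q < n q := by
  rw [eventually_all]
  intro q
  filter_upwards [((tendsto_eval_atTop q).atTop_mul_const (hx q).1).eventually_ge_atTop
      (|(δ q : ℝ)| + 1),
    ((tendsto_eval_atTop q).atTop_mul_const (sub_pos.2 (hx q).2)).eventually_ge_atTop
      (|(δ q : ℝ)| + 1)] with n h1 h2
  have h3 := Int.floor_le ((n q : ℝ) * x q)
  have h4 := Int.lt_floor_add_one ((n q : ℝ) * x q)
  have h5 := abs_le.1 (le_refl |(δ q : ℝ)|)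
  constructor
  · have : (0 : ℝ) ≤ (((cellIdx n x + δ) q : ℤ) : ℝ) := by
      simp only [Pi.add_apply, cellIdx, Int.cast_add]
      linarith
    exact_mod_cast this
  · have : (((cellIdx n x + δ) q : ℤ) : ℝ) < n q := by
      simp only [Pi.add_apply, cellIdx, Int.cast_add]
      linarith
    exact_mod_cast this

variable {d m ν : ℕ} [NeZero d]

/-- The position of a node in the infinite lattice. -/
def latticePos {Ω : Set (Fin d → ℝ)} {n : Fin d → ℕ} (v : NodeIn Ω n ν) :
    (Fin d → ℤ) × Fin ν :=
  (fun q => ((v.1.1 q : ℕ) : ℤ), v.1.2)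

/-- The extension of the immersion to the infinite lattice. -/
noncomputable def latticeImmersion (n : Fin d → ℕ) (a : (Fin d → ℤ) × Fin ν) : Fin d → ℝ :=
  fun q =>
    if q = 0 then ((a.1 q : ℝ) * (ν : ℝ) + (a.2 : ℕ) + 1) / ((ν : ℝ) * n q + 1)
    else ((a.1 q : ℝ) + 1) / ((n q : ℝ) + 1)

theorem latticeImmersion_latticePos {Ω : Set (Fin d → ℝ)} {n : Fin d → ℕ} (v : NodeIn Ω n ν) :
    latticeImmersion n (latticePos v) = immersion v.1 := by
  funext q
  simp [latticeImmersion, latticePos, immersion]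

theorem latticePos_injective {Ω : Set (Fin d → ℝ)} {n : Fin d → ℕ} :
    Function.Injective (latticePos : NodeIn Ω n ν → _) := by
  intro v w h
  have h1 := congrArg Prod.fst h
  have h2 := congrArg Prod.snd h
  refine Subtype.ext (Prod.ext (funext fun q => Fin.ext ?_) h2)
  have := congrFun h1 q
  simpa [latticePos] using this

theorem mem_range_latticePos {Ω : Set (Fin d → ℝ)} {n : Fin d → ℕ} {a : (Fin d → ℤ) × Fin ν} :
    a ∈ Set.range (latticePos : NodeIn Ω n ν → _) ↔
      (∀ q, 0 ≤ a.1 q ∧ a.1 q < n q) ∧ latticeImmersion n a ∈ Ω := by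
  constructor
  · rintro ⟨v, rfl⟩
    refine ⟨fun q => ⟨by simp [latticePos], by simp [latticePos]⟩, ?_⟩
    rw [latticeImmersion_latticePos]
    exact v.2
  · rintro ⟨h, hΩ⟩
    let u : Node n ν := (fun q => ⟨(a.1 q).toNat, by have := h q; omega⟩, a.2)
    have hu : (fun q => ((u.1 q : ℕ) : ℤ)) = a.1 := funext fun q => by
      have := h q
      simp only [u]
      omega
    have hi : latticeImmersion n a = immersion u := by
      funext q
      have : (a.1 q : ℝ) = ((u.1 q : ℕ) : ℝ) := by
        rw [← hu]; simp
      simp only [latticeImmersion, immersion, this, u]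
    exact ⟨⟨u, hi ▸ hΩ⟩, Prod.ext hu rfl⟩

/-- The complex adjacency matrix of the grid graph in `Ω`. -/
noncomputable abbrev gridMatrix (S : DiamondData d m ν) (Ω : Set (Fin d → ℝ))
    (p : (Fin d → ℝ) → ℝ) (n : Fin d → ℕ) : Matrix (NodeIn Ω n ν) (NodeIn Ω n ν) ℂ :=
  (gridGraphIn S Ω p n).adjMatrix.map Complex.ofReal

theorem gridMatrix_isHermitian (S : DiamondData d m ν) (Ω : Set (Fin d → ℝ))
    (p : (Fin d → ℝ) → ℝ) (n : Fin d → ℕ) : (gridMatrix S Ω p n).IsHermitian := by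
  ext u v
  simp only [Matrix.conjTranspose_apply, Matrix.map_apply, WGraph.adjMatrix, Matrix.of_apply,
    Complex.star_def, Complex.conj_ofReal]
  rw [(gridGraphIn S Ω p n).symm]

/-- The weights of the grid graph as a function on the infinite lattice. -/
noncomputable def latticeWeight (S : DiamondData d m ν) (p : (Fin d → ℝ) → ℝ) (n : Fin d → ℕ)
    (a b : (Fin d → ℤ) × Fin ν) : ℝ :=
  p ((1 / 2 : ℝ) • (latticeImmersion n a + latticeImmersion n b)) *
    S.fullBlock (a.1 - b.1) a.2 b.2

theorem gridMatrix_apply (S : DiamondData d m ν) (Ω : Set (Fin d → ℝ))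
    (p : (Fin d → ℝ) → ℝ) (n : Fin d → ℕ) (u v : NodeIn Ω n ν) :
    gridMatrix S Ω p n u v = (latticeWeight S p n (latticePos u) (latticePos v) : ℂ) := by
  rw [latticeWeight, latticeImmersion_latticePos, latticeImmersion_latticePos]
  change ((p _ * (S.graph n).w u.1 v.1 : ℝ) : ℂ) = _
  rw [S.graph_w_eq]
  rfl

/-- The entries of the `k`-th power of the adjacency matrix, extended by zero to the lattice. -/
noncomputable def powExt (S : DiamondData d m ν) (Ω : Set (Fin d → ℝ))
    (p : (Fin d → ℝ) → ℝ) (n : Fin d → ℕ) (k : ℕ) (a b : (Fin d → ℤ) × Fin ν) : ℂ :=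
  Function.extend (Prod.map latticePos latticePos)
    (fun u : NodeIn Ω n ν × NodeIn Ω n ν => (gridMatrix S Ω p n ^ k) u.1 u.2) 0 (a, b)

section

variable {S : DiamondData d m ν} {Ω : Set (Fin d → ℝ)} {p : (Fin d → ℝ) → ℝ} {n : Fin d → ℕ}

theorem powExt_latticePos (k : ℕ) (u v : NodeIn Ω n ν) :
    powExt S Ω p n k (latticePos u) (latticePos v) = (gridMatrix S Ω p n ^ k) u v :=
  (latticePos_injective.prodMap latticePos_injective).extend_apply _ _ (u, v)

theorem powExt_eq_zero (k : ℕ) {a b : (Fin d → ℤ) × Fin ν}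
    (h : a ∉ Set.range (latticePos : NodeIn Ω n ν → _)) : powExt S Ω p n k a b = 0 := by
  rw [powExt, Function.extend_apply']
  · rfl
  · rintro ⟨u, hu⟩
    exact h ⟨u.1, congrArg Prod.fst hu⟩

theorem powExt_zero {a b : (Fin d → ℤ) × Fin ν}
    (ha : a ∈ Set.range (latticePos : NodeIn Ω n ν → _))
    (hb : b ∈ Set.range (latticePos : NodeIn Ω n ν → _)) :
    powExt S Ω p n 0 a b = if a = b then 1 else 0 := by
  obtain ⟨u, rfl⟩ := ha
  obtain ⟨v, rfl⟩ := hb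
  rw [powExt_latticePos, pow_zero, Matrix.one_apply]
  simp only [latticePos_injective.eq_iff]

/-- The matrix product becomes a sum over a range independent of `n`, so that limits can be taken
term by term. Both sums equal the sum of one function over the whole lattice: off the nodes `powExt`
vanishes, and off the translated stencil the weight vanishes. -/
theorem powExt_succ (k : ℕ) {a b : (Fin d → ℤ) × Fin ν}
    (ha : a ∈ Set.range (latticePos : NodeIn Ω n ν → _))
    (hb : b ∈ Set.range (latticePos : NodeIn Ω n ν → _)) :
    powExt S Ω p n (k + 1) a b = ∑ β ∈ S.stencil, ∑ r,
      (latticeWeight S p n a (a.1 - β, r) : ℂ) * powExt S Ω p n k (a.1 - β, r) b := by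
  obtain ⟨u, rfl⟩ := ha
  obtain ⟨v, rfl⟩ := hb
  rw [powExt_latticePos, pow_succ', Matrix.mul_apply]
  simp only [gridMatrix_apply, ← powExt_latticePos]
  set g : (Fin d → ℤ) × Fin ν → ℂ := fun c =>
    (latticeWeight S p n (latticePos u) c : ℂ) * powExt S Ω p n k c (latticePos v) with hg
  have h1 : Function.support g ⊆ Set.range (latticePos : NodeIn Ω n ν → _) := by
    intro c hc
    by_contra h
    exact hc (by simp only [hg]; rw [powExt_eq_zero k h, mul_zero])
  have h2 : ∀ c ∉ S.stencil.image (fun β => (latticePos u).1 - β) ×ˢ Finset.univ, g c = 0 := by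
    intro c hc
    have : (latticePos u).1 - c.1 ∉ S.stencil := fun h => hc <| by
      rw [Finset.mem_product]
      exact ⟨Finset.mem_image.2 ⟨_, h, sub_sub_cancel _ _⟩, Finset.mem_univ _⟩
    simp only [hg, latticeWeight, S.fullBlock_eq_zero this]
    simp
  have h3 := latticePos_injective.tsum_eq h1
  rw [tsum_fintype, tsum_eq_sum h2, Finset.sum_product,
    Finset.sum_image fun β _ γ _ h => sub_right_injective h] at h3
  exact h3

end

/-- In each coordinate the numerator differs from `x q` times the denominator by a bounded amount,
whatever the fixed offset `δ` and the place `s` in the diamond. -/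
theorem tendsto_latticeImmersion (hν : 0 < ν) (x : Fin d → ℝ) (δ : Fin d → ℤ) (s : Fin ν) :
    Tendsto (fun n : Fin d → ℕ => latticeImmersion n (cellIdx n x + δ, s)) atTop (𝓝 x) := by
  rw [tendsto_pi_nhds]
  intro q
  have hν' : (0 : ℝ) < ν := by exact_mod_cast hν
  have hf : ∀ n : Fin d → ℕ, |(cellIdx n x q : ℝ) - n q * x q| ≤ 1 := fun n => by
    rw [abs_sub_comm, abs_le]
    have h1 := Int.floor_le ((n q : ℝ) * x q)
    have h2 := Int.lt_floor_add_one ((n q : ℝ) * x q)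
    constructor <;> simp only [cellIdx] <;> linarith
  by_cases hq : q = 0
  · simp only [latticeImmersion, if_pos hq]
    refine tendsto_div_of_abs_sub_le (C := ν + (|(δ q : ℝ) * ν + s + 1| + |x q|))
      (tendsto_atTop_add_const_right _ _ ((tendsto_eval_atTop q).const_mul_atTop hν')) fun n => ?_
    have e : ((cellIdx n x + δ) q : ℝ) * ν + (s : ℕ) + 1 - x q * (ν * n q + 1)
        = ν * ((cellIdx n x q : ℝ) - n q * x q) + ((δ q * ν + s + 1) - x q) := by
      push_cast [Pi.add_apply]
      ring
    rw [e]
    refine (abs_add_le _ _).trans (add_le_add ?_ (abs_sub _ _))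
    rw [abs_mul, abs_of_pos hν']
    exact mul_le_of_le_one_right hν'.le (hf n)
  · simp only [latticeImmersion, if_neg hq]
    refine tendsto_div_of_abs_sub_le (C := 1 + (|(δ q : ℝ) + 1| + |x q|))
      (tendsto_atTop_add_const_right _ _ (tendsto_eval_atTop q)) fun n => ?_
    have e : ((cellIdx n x + δ) q : ℝ) + 1 - x q * (n q + 1)
        = ((cellIdx n x q : ℝ) - n q * x q) + ((δ q + 1) - x q) := by
      push_cast [Pi.add_apply]
      ring
    rw [e]
    exact (abs_add_le _ _).trans (add_le_add (hf n) (abs_sub _ _))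

section Local

variable {S : DiamondData d m ν} {Ω : Set (Fin d → ℝ)} {p : (Fin d → ℝ) → ℝ} {x : Fin d → ℝ}

theorem eventually_mem_range_latticePos (hν : 0 < ν) (hx : ∀ q, x q ∈ Set.Ioo 0 1)
    (hxΩ : x ∈ interior Ω) (δ : Fin d → ℤ) (s : Fin ν) :
    ∀ᶠ n : Fin d → ℕ in atTop,
      ((cellIdx n x + δ, s) : _ × _) ∈ Set.range (latticePos : NodeIn Ω n ν → _) := by
  filter_upwards [eventually_cellIdx_mem hx δ,
    (tendsto_latticeImmersion hν x δ s).eventually (mem_interior_iff_mem_nhds.1 hxΩ)] with n h1 h2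
  exact mem_range_latticePos.2 ⟨h1, h2⟩

theorem tendsto_latticeWeight (hν : 0 < ν) (hp : ContinuousAt p x) (δ ε : Fin d → ℤ)
    (r s : Fin ν) :
    Tendsto (fun n : Fin d → ℕ => latticeWeight S p n (cellIdx n x + δ, r) (cellIdx n x + ε, s))
      atTop (𝓝 (p x * S.fullBlock (δ - ε) r s)) := by
  simp only [latticeWeight, add_sub_add_left_eq_sub]
  refine (hp.tendsto.comp ?_).mul_const _
  have h := ((tendsto_latticeImmersion hν x δ r).add
    (tendsto_latticeImmersion hν x ε s)).const_smul (1 / 2 : ℝ)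
  have e : (1 / 2 : ℝ) • (x + x) = x := by
    rw [← two_smul ℝ x, smul_smul]
    norm_num
  rwa [e] at h

/-- Induction on `k`, comparing `powExt_succ` with `powCoeff_succ`. Only the diagonal offset is used
later, but each step of a walk moves its starting point, so the induction needs all `δ` and `r`. -/
theorem tendsto_powExt (hν : 0 < ν) (hx : ∀ q, x q ∈ Set.Ioo 0 1)
    (hxΩ : x ∈ interior Ω) (hp : ContinuousAt p x) (k : ℕ) (δ : Fin d → ℤ) (r s : Fin ν) :
    Tendsto (fun n : Fin d → ℕ => powExt S Ω p n k (cellIdx n x + δ, r) (cellIdx n x + 0, s)) atTop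
      (𝓝 ((p x : ℂ) ^ k * S.powCoeff k δ r s)) := by
  induction k generalizing δ r with
  | zero =>
    refine tendsto_const_nhds.congr' ?_
    filter_upwards [eventually_mem_range_latticePos hν hx hxΩ δ r,
      eventually_mem_range_latticePos hν hx hxΩ 0 s] with n h1 h2
    rw [powExt_zero h1 h2, S.powCoeff_zero]
    simp
  | succ k ih =>
    have h : Tendsto (fun n : Fin d → ℕ => ∑ β ∈ S.stencil, ∑ r',
        (latticeWeight S p n (cellIdx n x + δ, r) (cellIdx n x + (δ - β), r') : ℂ) *
          powExt S Ω p n k (cellIdx n x + (δ - β), r') (cellIdx n x + 0, s)) atTop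
        (𝓝 (∑ β ∈ S.stencil, ∑ r', ((p x * S.fullBlock (δ - (δ - β)) r r' : ℝ) : ℂ) *
          ((p x : ℂ) ^ k * S.powCoeff k (δ - β) r' s))) :=
      tendsto_finsetSum _ fun β _ => tendsto_finsetSum _ fun r' _ =>
        ((Complex.continuous_ofReal.tendsto _).comp (tendsto_latticeWeight hν hp _ _ _ _)).mul
          (ih (δ - β) r')
    have e : (p x : ℂ) ^ (k + 1) * S.powCoeff (k + 1) δ r s =
        ∑ β ∈ S.stencil, ∑ r', ((p x * S.fullBlock (δ - (δ - β)) r r' : ℝ) : ℂ) *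
          ((p x : ℂ) ^ k * S.powCoeff k (δ - β) r' s) := by
      simp only [S.powCoeff_succ, Finset.mul_sum, sub_sub_cancel]
      refine Finset.sum_congr rfl fun β _ => Finset.sum_congr rfl fun r' _ => ?_
      push_cast
      ring
    rw [e]
    refine h.congr' ?_
    filter_upwards [eventually_mem_range_latticePos hν hx hxΩ δ r,
      eventually_mem_range_latticePos hν hx hxΩ 0 s] with n h1 h2
    rw [powExt_succ k h1 h2]
    simp only [add_sub_assoc]

end Local

end DiamondToeplitz

namespace DiamondToeplitz

/-! ### Sums over the cells as integrals -/

/-- The cell of the index `i` in the unit cube. -/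
def cell {d : ℕ} (n : Fin d → ℕ) (i : (q : Fin d) → Fin (n q)) : Set (Fin d → ℝ) :=
  Set.univ.pi fun q => Set.Ico (((i q : ℕ) : ℝ) / n q) ((((i q : ℕ) : ℝ) + 1) / n q)

/-- The half-open unit cube. -/
def unitCube (d : ℕ) : Set (Fin d → ℝ) := Set.univ.pi fun _ => Set.Ico 0 1

theorem measurableSet_unitCube (d : ℕ) : MeasurableSet (unitCube d) :=
  MeasurableSet.univ_pi fun _ => measurableSet_Ico

theorem volume_unitCube (d : ℕ) : volume (unitCube d) = 1 := by
  simp [unitCube, Real.volume_pi_Ico]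

section Cells

variable {d : ℕ} {n : Fin d → ℕ}

theorem measurableSet_cell (i : (q : Fin d) → Fin (n q)) : MeasurableSet (cell n i) :=
  MeasurableSet.univ_pi fun _ => measurableSet_Ico

theorem cell_subset_unitCube (i : (q : Fin d) → Fin (n q)) : cell n i ⊆ unitCube d := by
  intro x hx q hq
  have h := hx q hq
  have hn : (0 : ℝ) < n q := by exact_mod_cast (i q).pos
  have hi : ((i q : ℕ) : ℝ) + 1 ≤ n q := by exact_mod_cast (i q).2
  exact ⟨le_trans (by positivity) h.1, h.2.trans_le ((div_le_one hn).2 hi)⟩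

theorem volume_real_cell (i : (q : Fin d) → Fin (n q)) :
    volume.real (cell n i) = (∏ q, (n q : ℝ))⁻¹ := by
  rw [measureReal_def, cell, Real.volume_pi_Ico, ENNReal.toReal_prod, ← Finset.prod_inv_distrib]
  refine Finset.prod_congr rfl fun q _ => ?_
  have hn : (0 : ℝ) < n q := by exact_mod_cast (i q).pos
  rw [← sub_div, add_sub_cancel_left, one_div, ENNReal.toReal_ofReal (by positivity)]

theorem mem_cell_iff (i : (q : Fin d) → Fin (n q)) (x : Fin d → ℝ) :
    x ∈ cell n i ↔ cellIdx n x = fun q => ((i q : ℕ) : ℤ) := by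
  rw [funext_iff]
  simp only [cell, Set.mem_pi, Set.mem_univ, true_implies]
  refine forall_congr' fun q => ?_
  have hn : (0 : ℝ) < n q := by exact_mod_cast (i q).pos
  rw [cellIdx, Int.floor_eq_iff, Set.mem_Ico, div_le_iff₀' hn, lt_div_iff₀' hn]
  simp

theorem exists_cellIdx_eq (hn : ∀ q, 0 < n q) {x : Fin d → ℝ} (hx : x ∈ unitCube d) :
    ∃ i : (q : Fin d) → Fin (n q), cellIdx n x = fun q => ((i q : ℕ) : ℤ) := by
  have h0 : ∀ q, 0 ≤ cellIdx n x q := fun q =>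
    Int.floor_nonneg.2 (mul_nonneg (Nat.cast_nonneg _) (hx q trivial).1)
  have h1 : ∀ q, cellIdx n x q < n q := fun q => by
    rw [cellIdx, Int.floor_lt]
    have : (0 : ℝ) < n q := by exact_mod_cast hn q
    simpa using mul_lt_of_lt_one_right this (hx q trivial).2
  refine ⟨fun q => ⟨(cellIdx n x q).toNat, by have := h0 q; have := h1 q; omega⟩, ?_⟩
  funext q
  have := h0 q
  simp only
  omega

theorem comp_cellIdx_eq_sum (hn : ∀ q, 0 < n q) (A : (Fin d → ℤ) → ℂ) {x : Fin d → ℝ}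
    (hx : x ∈ unitCube d) :
    A (cellIdx n x) = ∑ i : (q : Fin d) → Fin (n q),
      (cell n i).indicator (fun _ => A fun q => ((i q : ℕ) : ℤ)) x := by
  obtain ⟨i, hi⟩ := exists_cellIdx_eq hn hx
  rw [Finset.sum_eq_single_of_mem i (Finset.mem_univ i),
    Set.indicator_of_mem ((mem_cell_iff i x).2 hi), hi]
  intro j _ hj
  refine Set.indicator_of_notMem (fun h => hj ?_) _
  rw [mem_cell_iff, hi] at h
  funext q
  have := congrFun h q
  exact Fin.ext (by exact_mod_cast this.symm)

theorem aestronglyMeasurable_comp_cellIdx (hn : ∀ q, 0 < n q) (A : (Fin d → ℤ) → ℂ) :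
    AEStronglyMeasurable (fun x => A (cellIdx n x)) (volume.restrict (unitCube d)) := by
  have h : StronglyMeasurable fun x : Fin d → ℝ => ∑ i : (q : Fin d) → Fin (n q),
      (cell n i).indicator (fun _ => A fun q => ((i q : ℕ) : ℤ)) x :=
    Finset.stronglyMeasurable_fun_sum _ fun i _ =>
      stronglyMeasurable_const.indicator (measurableSet_cell i)
  refine h.aestronglyMeasurable.congr ?_
  filter_upwards [ae_restrict_mem (measurableSet_unitCube d)] with x hx
  exact (comp_cellIdx_eq_sum hn A hx).symm

/-- This moves sums over varying index sets to a fixed measure space, where dominated convergence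
applies. -/
theorem integral_comp_cellIdx (hn : ∀ q, 0 < n q) (A : (Fin d → ℤ) → ℂ) :
    ∫ x in unitCube d, A (cellIdx n x) =
      (∏ q, (n q : ℂ))⁻¹ * ∑ i : (q : Fin d) → Fin (n q), A fun q => ((i q : ℕ) : ℤ) := by
  have hfin : volume (unitCube d) ≠ ⊤ := by rw [volume_unitCube]; exact ENNReal.one_ne_top
  rw [setIntegral_congr_fun (measurableSet_unitCube d) fun x hx => comp_cellIdx_eq_sum hn A hx,
    integral_finsetSum _ fun i _ => ?_, Finset.mul_sum]
  · refine Finset.sum_congr rfl fun i _ => ?_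
    rw [setIntegral_indicator (measurableSet_cell i),
      Set.inter_eq_self_of_subset_right (cell_subset_unitCube i), setIntegral_const,
      volume_real_cell, Complex.real_smul]
    push_cast
    rfl
  · exact (integrableOn_const hfin).indicator (measurableSet_cell i)

end Cells

/-! ### Regular domains

A regular domain is almost everywhere equal to its interior. -/

section RegularDomain

variable {d : ℕ} {Ω : Set (Fin d → ℝ)} {p : (Fin d → ℝ) → ℝ}

theorem mem_Ioo_of_mem_interior (h : Ω ⊆ Set.Icc 0 1) {x : Fin d → ℝ} (hx : x ∈ interior Ω)
    (q : Fin d) : x q ∈ Set.Ioo 0 1 := by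
  have h1 := interior_mono h hx
  rw [← Set.pi_univ_Icc, interior_pi_set Set.finite_univ] at h1
  have h2 := h1 q trivial
  simpa only [interior_Icc, Pi.zero_apply, Pi.one_apply] using h2

theorem IsRegularDomain.interior_ae_eq (hΩ : IsRegularDomain Ω) : interior Ω =ᵐ[volume] Ω := by
  refine (LE.le.eventuallyLE interior_subset).antisymm ?_
  have : ∀ᵐ x, x ∉ frontier Ω := measure_eq_zero_iff_ae_notMem.1 hΩ.frontier_null
  filter_upwards [this] with x hx hxΩ
  by_contra h
  exact hx ⟨subset_closure hxΩ, h⟩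

/-- At interior points continuity relative to `Ω` is continuity, so the values of `p` outside `Ω`
play no role. -/
theorem IsRegularDomain.ae_continuousAt (hΩ : IsRegularDomain Ω)
    (hp : ∀ᵐ x ∂(volume.restrict Ω), ContinuousWithinAt p Ω x) :
    ∀ᵐ x, x ∈ interior Ω → ContinuousAt p x := by
  filter_upwards [(ae_restrict_iff'₀ hΩ.nullMeasurable).1 hp] with x hx hxi
  exact (hx (interior_subset hxi)).continuousAt (mem_interior_iff_mem_nhds.1 hxi)

end RegularDomain

/-! ### Local spectral sums -/

variable {d m ν : ℕ} [NeZero d]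

/-- The mass at the `j`-th eigenvalue of the spectral measure at the lattice point `a`; it vanishes
if `a` is not a node. -/
noncomputable def latticeSpectralWeight (S : DiamondData d m ν) (Ω : Set (Fin d → ℝ))
    (p : (Fin d → ℝ) → ℝ) (n : Fin d → ℕ) (a : (Fin d → ℤ) × Fin ν) (j : NodeIn Ω n ν) : ℝ :=
  Function.extend latticePos
    (fun v : NodeIn Ω n ν => spectralWeight (gridMatrix_isHermitian S Ω p n) v j) 0 a

/-- The sum of the values of `F` at the eigenvalues, weighted by the spectral measures at the nodes
of the `a`-th diamond. -/
noncomputable def localEigSum (S : DiamondData d m ν) (Ω : Set (Fin d → ℝ))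
    (p : (Fin d → ℝ) → ℝ) (F : ℂ → ℂ) (n : Fin d → ℕ) (a : Fin d → ℤ) : ℂ :=
  ∑ r : Fin ν, ∑ j, (latticeSpectralWeight S Ω p n (a, r) j : ℂ) *
    F ((gridMatrix_isHermitian S Ω p n).eigenvalues j)

section

variable {S : DiamondData d m ν} {Ω : Set (Fin d → ℝ)} {p : (Fin d → ℝ) → ℝ} {n : Fin d → ℕ}
  {F : ℂ → ℂ} {M : ℝ}

theorem latticeSpectralWeight_latticePos (v j : NodeIn Ω n ν) :
    latticeSpectralWeight S Ω p n (latticePos v) j =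
      spectralWeight (gridMatrix_isHermitian S Ω p n) v j :=
  latticePos_injective.extend_apply _ _ v

theorem latticeSpectralWeight_eq_zero {a : (Fin d → ℤ) × Fin ν}
    (h : a ∉ Set.range (latticePos : NodeIn Ω n ν → _)) (j : NodeIn Ω n ν) :
    latticeSpectralWeight S Ω p n a j = 0 :=
  Function.extend_apply' _ _ _ h

theorem latticeSpectralWeight_nonneg (a : (Fin d → ℤ) × Fin ν) (j : NodeIn Ω n ν) :
    0 ≤ latticeSpectralWeight S Ω p n a j := by
  by_cases h : a ∈ Set.range (latticePos : NodeIn Ω n ν → _)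
  · obtain ⟨v, rfl⟩ := h
    rw [latticeSpectralWeight_latticePos]
    exact spectralWeight_nonneg _ _ _
  · rw [latticeSpectralWeight_eq_zero h]

theorem sum_latticeSpectralWeight_le (a : (Fin d → ℤ) × Fin ν) :
    ∑ j, latticeSpectralWeight S Ω p n a j ≤ 1 := by
  by_cases h : a ∈ Set.range (latticePos : NodeIn Ω n ν → _)
  · obtain ⟨v, rfl⟩ := h
    simp only [latticeSpectralWeight_latticePos]
    exact (sum_spectralWeight_right _ _).le
  · simp only [latticeSpectralWeight_eq_zero h, Finset.sum_const_zero, zero_le_one]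

theorem sum_latticeSpectralWeight_mul_pow (a : (Fin d → ℤ) × Fin ν) (k : ℕ) :
    ∑ j, (latticeSpectralWeight S Ω p n a j : ℂ) *
      ((gridMatrix_isHermitian S Ω p n).eigenvalues j : ℂ) ^ k = powExt S Ω p n k a a := by
  by_cases h : a ∈ Set.range (latticePos : NodeIn Ω n ν → _)
  · obtain ⟨v, rfl⟩ := h
    rw [powExt_latticePos, pow_apply_self_eq_sum (gridMatrix_isHermitian S Ω p n)]
    simp only [latticeSpectralWeight_latticePos]
  · simp only [latticeSpectralWeight_eq_zero h, powExt_eq_zero k h, Complex.ofReal_zero, zero_mul,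
      Finset.sum_const_zero]

theorem localEigSum_eq_zero {a : Fin d → ℤ}
    (h : ∀ r : Fin ν, latticeImmersion n (a, r) ∉ Ω) : localEigSum S Ω p F n a = 0 := by
  refine Finset.sum_eq_zero fun r _ => Finset.sum_eq_zero fun j _ => ?_
  rw [latticeSpectralWeight_eq_zero fun hr => h r (mem_range_latticePos.1 hr).2,
    Complex.ofReal_zero, zero_mul]

theorem norm_localEigSum_le (hM : ∀ x : ℝ, ‖F x‖ ≤ M) (a : Fin d → ℤ) :
    ‖localEigSum S Ω p F n a‖ ≤ ν * M := by
  have hM0 : 0 ≤ M := (norm_nonneg _).trans (hM 0)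
  have h : ∀ r : Fin ν, ‖∑ j, (latticeSpectralWeight S Ω p n (a, r) j : ℂ) *
      F ((gridMatrix_isHermitian S Ω p n).eigenvalues j)‖ ≤ M := fun r => by
    refine (norm_sum_le _ _).trans ?_
    calc _ ≤ ∑ j, latticeSpectralWeight S Ω p n (a, r) j * M := Finset.sum_le_sum fun j _ => by
          rw [norm_mul, Complex.norm_real, Real.norm_of_nonneg (latticeSpectralWeight_nonneg _ _)]
          exact mul_le_mul_of_nonneg_left (hM _) (latticeSpectralWeight_nonneg _ _)
      _ ≤ M := by
          rw [← Finset.sum_mul]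
          exact mul_le_of_le_one_left hM0 (sum_latticeSpectralWeight_le _)
  refine (norm_sum_le _ _).trans ((Finset.sum_le_card_nsmul _ _ M fun r _ => h r).trans ?_)
  simp

/-- For each eigenvalue the spectral weights at all nodes add up to `1`. The sums over the box and
over the nodes in `Ω` are compared through the lattice, where the summand is supported on the
latter. -/
theorem sum_localEigSum :
    ∑ i : (q : Fin d) → Fin (n q), localEigSum S Ω p F n (fun q => ((i q : ℕ) : ℤ)) =
      eigSum F (gridMatrix S Ω p n) := by
  set g : (Fin d → ℤ) × Fin ν → ℂ := fun a => ∑ j, (latticeSpectralWeight S Ω p n a j : ℂ) *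
    F ((gridMatrix_isHermitian S Ω p n).eigenvalues j) with hg
  let f : Node n ν → (Fin d → ℤ) × Fin ν := fun v => (fun q => ((v.1 q : ℕ) : ℤ), v.2)
  have hf : Function.Injective f := by
    intro v w h
    refine Prod.ext (funext fun q => Fin.ext ?_) (Prod.ext_iff.1 h).2
    have := congrFun (Prod.ext_iff.1 h).1 q
    simpa [f] using this
  have hs : Function.support g ⊆ Set.range (latticePos : NodeIn Ω n ν → _) := by
    intro a ha
    by_contra h
    refine ha (Finset.sum_eq_zero fun j _ => ?_)
    rw [latticeSpectralWeight_eq_zero h, Complex.ofReal_zero, zero_mul]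
  have hs' : Function.support g ⊆ Set.range f := hs.trans (by
    rintro _ ⟨v, rfl⟩
    exact ⟨v.1, rfl⟩)
  have h1 := (hf.tsum_eq hs').trans (latticePos_injective.tsum_eq hs).symm
  rw [tsum_fintype, tsum_fintype, Fintype.sum_prod_type] at h1
  refine Eq.trans h1 ?_
  rw [eigSum_eq_sum_eigenvalues (gridMatrix_isHermitian S Ω p n)]
  simp only [hg, latticeSpectralWeight_latticePos]
  rw [Finset.sum_comm]
  refine Finset.sum_congr rfl fun j _ => ?_
  rw [← Finset.sum_mul, ← Complex.ofReal_sum, sum_spectralWeight_left, Complex.ofReal_one, one_mul]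

end

/-! ### Eigenvalue bounds and integrability for multiples of the symbol -/

section Symbol

theorem smul_symbol_isHermitian {d : ℕ} (S : DiamondData d m ν) (c : ℝ) (θ : Fin d → ℝ) :
    ((c : ℂ) • S.symbol θ).IsHermitian := by
  have h := S.symbol_isHermitian θ
  rw [Matrix.IsHermitian, Matrix.conjTranspose_smul, h.eq, Complex.star_def, Complex.conj_ofReal]

theorem aemeasurable_smul_symbol {d : ℕ} (S : DiamondData d m ν) (c : ℝ) {μ : Measure (Fin d → ℝ)}
    (r s : Fin ν) : AEMeasurable (fun θ => ((c : ℂ) • S.symbol θ) r s) μ := by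
  simp only [Matrix.smul_apply, smul_eq_mul]
  exact (continuous_const.mul (S.continuous_symbol_apply r s)).aemeasurable

/-- This supplies the compact support required by the moment method: the trace of the square is
bounded on the compact cube and controls the eigenvalues. -/
theorem exists_abs_eigenvalues_le {d : ℕ} (S : DiamondData d m ν) (c : ℝ) :
    ∃ ρ : ℝ, ∀ θ ∈ Set.Icc (fun _ : Fin d => -Real.pi) fun _ => Real.pi,
      ∀ s, |(smul_symbol_isHermitian S c θ).eigenvalues s| ≤ ρ := by
  have hc : Continuous fun θ : Fin d → ℝ => (((c : ℂ) • S.symbol θ) ^ 2).trace := by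
    have h : Continuous S.symbol := continuous_matrix S.continuous_symbol_apply
    have h' : Continuous fun θ => (c : ℂ) • S.symbol θ := h.const_smul (c : ℂ)
    exact (h'.pow 2).matrix_trace
  obtain ⟨C, hC⟩ := (isCompact_Icc (a := fun _ : Fin d => -Real.pi)
    (b := fun _ => Real.pi)).exists_bound_of_continuousOn hc.continuousOn
  exact ⟨C + 1, fun θ hθ s => abs_eigenvalue_le _ (hC θ hθ) s⟩

theorem norm_sum_eigenvalues_le {V : Type*} [Fintype V] [DecidableEq V] {A : Matrix V V ℂ}
    (hA : A.IsHermitian) {G : ℝ → ℂ} {M : ℝ} (hM : ∀ s, ‖G (hA.eigenvalues s)‖ ≤ M) :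
    ‖∑ s, G (hA.eigenvalues s)‖ ≤ Fintype.card V * M := by
  refine (norm_sum_le _ _).trans ((Finset.sum_le_card_nsmul _ _ M fun s _ => hM s).trans ?_)
  simp

theorem integrable_sum_eigenvalues_symbol {d : ℕ} (S : DiamondData d m ν) (c : ℝ) {G : ℝ → ℂ}
    (hG : Continuous G) :
    Integrable (fun θ => ∑ s, G ((smul_symbol_isHermitian S c θ).eigenvalues s))
      (uniformCube d (-Real.pi) Real.pi) := by
  have := isProbabilityMeasure_uniformCube d (neg_lt_self Real.pi_pos)
  obtain ⟨ρ, hρ⟩ := exists_abs_eigenvalues_le S c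
  obtain ⟨C, hC⟩ := (isCompact_Icc (a := -ρ) (b := ρ)).exists_bound_of_continuousOn hG.continuousOn
  refine Integrable.of_bound (C := Fintype.card (Fin ν) * C)
    (aestronglyMeasurable_sum_eigenvalues (smul_symbol_isHermitian S c)
      (aemeasurable_smul_symbol S c) hG) ?_
  · filter_upwards [ae_mem_Icc_uniformCube (neg_lt_self Real.pi_pos)] with θ hθ
    exact norm_sum_eigenvalues_le _ fun s => hC _ (abs_le.1 (hρ θ hθ s))

end Symbol

/-! ### Limits of the local and of the global eigenvalue sums -/

section Limit

variable {S : DiamondData d m ν} {Ω : Set (Fin d → ℝ)} {p : (Fin d → ℝ) → ℝ} {F : ℂ → ℂ} {M : ℝ}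

/-- The moment method for the spectral measures summed over one diamond; their moments converge by
`tendsto_powExt` at offset `0`, whose limit is a torus mean of traces by
`integral_trace_symbol_pow`. -/
theorem tendsto_localEigSum (hν : 0 < ν) {x : Fin d → ℝ} (hx : ∀ q, x q ∈ Set.Ioo 0 1)
    (hxΩ : x ∈ interior Ω) (hp : ContinuousAt p x) (hF : Continuous F)
    (hM : ∀ x : ℝ, ‖F x‖ ≤ M) :
    Tendsto (fun n : Fin d → ℕ => localEigSum S Ω p F n (cellIdx n x)) atTop
      (𝓝 (∫ θ, eigSum F ((p x : ℂ) • S.symbol θ) ∂(uniformCube d (-Real.pi) Real.pi))) := by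
  have := isProbabilityMeasure_uniformCube d (neg_lt_self Real.pi_pos)
  obtain ⟨ρ, hρ⟩ := exists_abs_eigenvalues_le S (p x)
  have key := tendsto_sum_of_moments (l := (atTop : Filter (Fin d → ℕ)))
    (J := fun n => NodeIn Ω n ν)
    (w := fun n j => ∑ r : Fin ν, latticeSpectralWeight S Ω p n (cellIdx n x, r) j)
    (lam := fun n j => (gridMatrix_isHermitian S Ω p n).eigenvalues j)
    (μ := uniformCube d (-Real.pi) Real.pi)
    (e := fun θ s => (smul_symbol_isHermitian S (p x) θ).eigenvalues s) (ρ := ρ)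
    (fun n j => Finset.sum_nonneg fun r _ => latticeSpectralWeight_nonneg _ _)
    (by
      filter_upwards [ae_mem_Icc_uniformCube (neg_lt_self Real.pi_pos)] with θ hθ s
      exact hρ θ hθ s)
    (fun G hG => integrable_sum_eigenvalues_symbol S (p x) hG)
    (fun k => by
      have h1 : Tendsto (fun n : Fin d → ℕ => ∑ r : Fin ν,
          powExt S Ω p n k (cellIdx n x + 0, r) (cellIdx n x + 0, r)) atTop
          (𝓝 (∑ r : Fin ν, (p x : ℂ) ^ k * S.powCoeff k 0 r r)) :=
        tendsto_finsetSum _ fun r _ => tendsto_powExt hν hx hxΩ hp k 0 r r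
      rw [← Finset.mul_sum, ← S.integral_trace_symbol_pow, ← integral_const_mul] at h1
      simp only [← trace_pow_eq_sum, smul_pow, Matrix.trace_smul, smul_eq_mul]
      refine h1.congr fun n => ?_
      simp only [add_zero, ← sum_latticeSpectralWeight_mul_pow]
      rw [Finset.sum_comm]
      refine Finset.sum_congr rfl fun j _ => ?_
      rw [← Finset.sum_mul, Complex.ofReal_sum])
    (hF.comp Complex.continuous_ofReal) hM
  simp only [eigSum_eq_sum_eigenvalues (smul_symbol_isHermitian S (p x) _)]
  refine key.congr fun n => ?_
  rw [localEigSum, Finset.sum_comm]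
  refine Finset.sum_congr rfl fun j _ => ?_
  rw [← Finset.sum_mul, Complex.ofReal_sum]
  rfl

/-- The eigenvalue sums of the grid graphs, normalized by the number of cells, converge. -/
theorem tendsto_inv_mul_eigSum (hν : 0 < ν) (S : DiamondData d m ν) (hΩ : IsRegularDomain Ω)
    (hp : ∀ᵐ x ∂(volume.restrict Ω), ContinuousWithinAt p Ω x) (hF : Continuous F)
    (hM : ∀ x : ℝ, ‖F x‖ ≤ M) :
    Tendsto (fun n : Fin d → ℕ => (∏ q, (n q : ℂ))⁻¹ * eigSum F (gridMatrix S Ω p n)) atTop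
      (𝓝 (∫ x in Ω, ∫ θ, eigSum F ((p x : ℂ) • S.symbol θ)
        ∂(uniformCube d (-Real.pi) Real.pi))) := by
  set L : (Fin d → ℝ) → ℂ := fun x => ∫ θ, eigSum F ((p x : ℂ) • S.symbol θ)
    ∂(uniformCube d (-Real.pi) Real.pi)
  have hpos : ∀ᶠ n : Fin d → ℕ in atTop, ∀ q, 0 < n q :=
    (eventually_ge_atTop (fun _ => 1)).mono fun n hn q => hn q
  have hsub : interior Ω ⊆ unitCube d := fun x hx q _ =>
    Set.Ioo_subset_Ico_self (mem_Ioo_of_mem_interior hΩ.subset_cube hx q)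
  have hfin : volume (unitCube d) ≠ ⊤ := by rw [volume_unitCube]; exact ENNReal.one_ne_top
  have hlim : ∫ x in Ω, L x = ∫ x in unitCube d, (interior Ω).indicator L x := by
    rw [setIntegral_indicator isOpen_interior.measurableSet,
      Set.inter_eq_self_of_subset_right hsub, setIntegral_congr_set hΩ.interior_ae_eq]
  rw [hlim]
  have hconv : Tendsto (fun n : Fin d → ℕ =>
      ∫ x in unitCube d, localEigSum S Ω p F n (cellIdx n x)) atTop
      (𝓝 (∫ x in unitCube d, (interior Ω).indicator L x)) := by
    -- Each of the `ν` spectral measures in a diamond has mass at most `1`, so the dominating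
    -- constant depends on `F` alone and `p` may be unbounded.
    refine tendsto_integral_filter_of_dominated_convergence (fun _ => ν * M)
      (hpos.mono fun n hn => aestronglyMeasurable_comp_cellIdx hn _)
      (Eventually.of_forall fun n => Eventually.of_forall fun x => norm_localEigSum_le hM _)
      (integrableOn_const hfin) (ae_restrict_of_ae ?_)
    filter_upwards [measure_eq_zero_iff_ae_notMem.1 hΩ.frontier_null,
      hΩ.ae_continuousAt hp] with x hx hxp
    by_cases hxi : x ∈ interior Ω
    · rw [Set.indicator_of_mem hxi]
      exact tendsto_localEigSum hν (mem_Ioo_of_mem_interior hΩ.subset_cube hxi) hxi (hxp hxi) hF hM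
    · rw [Set.indicator_of_notMem hxi]
      -- Off the frontier, a point that is not interior lies outside the closure; eventually no
      -- lattice point of its cell is immersed in `Ω`, and the local sum is zero.
      have hxc : x ∈ (closure Ω)ᶜ := fun h => hx ⟨h, hxi⟩
      have hev : ∀ᶠ n : Fin d → ℕ in atTop,
          ∀ r : Fin ν, latticeImmersion n (cellIdx n x + 0, r) ∉ Ω := by
        rw [eventually_all]
        intro r
        filter_upwards [(tendsto_latticeImmersion hν x 0 r).eventually
          (isClosed_closure.isOpen_compl.mem_nhds hxc)] with n hn h
        exact hn (subset_closure h)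
      refine tendsto_const_nhds.congr' (hev.mono fun n hn => ?_)
      simp only [add_zero] at hn
      exact (localEigSum_eq_zero hn).symm
  refine hconv.congr' (hpos.mono fun n hn => ?_)
  rw [integral_comp_cellIdx hn, sum_localEigSum]

end Limit

end DiamondToeplitz

namespace DiamondToeplitz

/-! ### Symmetry of the symbol under sign changes -/

/-- For `c ≠ 0`, `det (z - c M) = c ^ N det (z / c - M)`, where `N` is the size of `M`. It carries
the symmetry hypothesis from the symbol to its multiples by `p x`. -/
theorem charpoly_smul_congr {V : Type*} [Fintype V] [DecidableEq V] {A B : Matrix V V ℂ}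
    (h : A.charpoly = B.charpoly) (c : ℂ) : (c • A).charpoly = (c • B).charpoly := by
  rcases eq_or_ne c 0 with rfl | hc
  · rw [zero_smul, zero_smul]
  · refine Polynomial.funext fun z => ?_
    have key : ∀ M : Matrix V V ℂ,
        (c • M).charpoly.eval z = c ^ Fintype.card V * M.charpoly.eval (z / c) := fun M => by
      rw [Matrix.eval_charpoly, Matrix.eval_charpoly, ← Matrix.det_smul]
      congr 1
      ext i j
      by_cases hij : i = j
      · subst hij
        simp [mul_sub, mul_div_cancel₀ _ hc]
      · simp [Matrix.diagonal_apply_ne _ hij]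
    rw [key, key, h]

/-- Cut at `0`, the preimage of `s` consists of `s ∩ [0, b]` and the reflection of `s ∩ (0, b]`.
These have equal volume, and the factor `2` cancels against the doubled length of the interval. -/
theorem map_abs_uniformIcc {b : ℝ} (hb : 0 < b) :
    (uniformIcc (-b) b).map (fun x => |x|) = uniformIcc 0 b := by
  ext s hs
  rw [Measure.map_apply continuous_abs.measurable hs]
  simp only [uniformIcc, Measure.smul_apply, smul_eq_mul,
    Measure.restrict_apply (continuous_abs.measurable hs), Measure.restrict_apply hs]
  have h1 : (fun x : ℝ => |x|) ⁻¹' s ∩ Set.Icc (-b) b ∩ Set.Ici 0 = s ∩ Set.Icc 0 b := by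
    ext x
    simp only [Set.mem_inter_iff, Set.mem_preimage, Set.mem_Icc, Set.mem_Ici]
    constructor
    · rintro ⟨⟨h, -, h'⟩, h0⟩
      rw [abs_of_nonneg h0] at h
      exact ⟨h, h0, h'⟩
    · rintro ⟨h, h0, h'⟩
      exact ⟨⟨by rwa [abs_of_nonneg h0], by linarith, h'⟩, h0⟩
  have h2 : ((fun x : ℝ => |x|) ⁻¹' s ∩ Set.Icc (-b) b) \ Set.Ici 0 =
      Neg.neg ⁻¹' (s ∩ Set.Ioc 0 b) := by
    ext x
    simp only [Set.mem_inter_iff, Set.mem_preimage, Set.mem_Icc, Set.mem_Ici, Set.mem_sdiff,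
      Set.mem_Ioc, not_le]
    constructor
    · rintro ⟨⟨h, h', -⟩, h0⟩
      rw [abs_of_neg h0] at h
      exact ⟨h, by linarith, by linarith⟩
    · rintro ⟨h, h0, h'⟩
      have h0' : x < 0 := by linarith
      exact ⟨⟨by rwa [abs_of_neg h0'], by linarith, by linarith⟩, h0'⟩
  have h3 : volume (s ∩ Set.Ioc 0 b) = volume (s ∩ Set.Icc 0 b) :=
    measure_congr ((ae_eq_refl s).inter Ioc_ae_eq_Icc)
  rw [← measure_inter_add_sdiff _ (measurableSet_Ici (a := (0 : ℝ))), h1, h2,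
    Measure.measure_preimage_neg, h3, ← two_mul, ← mul_assoc]
  congr 1
  have e : b - -b = 2 * b := by ring
  rw [e, sub_zero, ENNReal.ofReal_mul zero_le_two, ENNReal.ofReal_ofNat,
    ENNReal.mul_inv (Or.inl two_ne_zero) (Or.inl ENNReal.ofNat_ne_top), mul_right_comm,
    ENNReal.inv_mul_cancel two_ne_zero ENNReal.ofNat_ne_top, one_mul]

theorem map_abs_uniformCube (d : ℕ) {b : ℝ} (hb : 0 < b) :
    (uniformCube d (-b) b).map (fun θ q => |θ q|) = uniformCube d 0 b := by
  have : SigmaFinite ((uniformIcc (-b) b).map fun x => |x|) := by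
    have := isProbabilityMeasure_uniformIcc hb
    rw [map_abs_uniformIcc hb]
    infer_instance
  unfold uniformCube
  rw [Measure.pi_map_pi (f := fun (_ : Fin d) (x : ℝ) => |x|)
    fun _ => continuous_abs.measurable.aemeasurable]
  simp only [map_abs_uniformIcc hb]

theorem integral_eigSum_symbol_eq {d m ν : ℕ} {S : DiamondData d m ν}
    (h : ∀ θ ∈ Set.Icc (fun _ : Fin d => -Real.pi) (fun _ => Real.pi),
      (S.symbol θ).charpoly = (S.symbol fun q => |θ q|).charpoly) {F : ℂ → ℂ} (hF : Continuous F)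
    (c : ℝ) :
    ∫ θ, eigSum F ((c : ℂ) • S.symbol θ) ∂(uniformCube d (-Real.pi) Real.pi) =
      ∫ θ, eigSum F ((c : ℂ) • S.symbol θ) ∂(uniformCube d 0 Real.pi) := by
  rw [← map_abs_uniformCube d Real.pi_pos, integral_map]
  · refine integral_congr_ae ?_
    filter_upwards [ae_mem_Icc_uniformCube (neg_lt_self Real.pi_pos)] with θ hθ
    rw [eigSum, eigSum, charpoly_smul_congr (h θ hθ)]
  · exact (measurable_pi_lambda _ fun q =>
      continuous_abs.measurable.comp (measurable_pi_apply q)).aemeasurable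
  · simp only [eigSum_eq_sum_eigenvalues (smul_symbol_isHermitian S c _)]
    exact aestronglyMeasurable_sum_eigenvalues (smul_symbol_isHermitian S c)
      (aemeasurable_smul_symbol S c)
      (hF.comp Complex.continuous_ofReal)

/-- In one dimension `|θ|` is `θ` or `-θ`, and the sign change transposes the symbol. -/
theorem charpoly_symbol_abs_of_unique {d m ν : ℕ} (hd : d = 1) (S : DiamondData d m ν)
    (θ : Fin d → ℝ) : (S.symbol θ).charpoly = (S.symbol fun q => |θ q|).charpoly := by
  subst hd
  rcases abs_choice (θ 0) with h | h
  · congr 2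
    funext q
    rw [Subsingleton.elim q 0, h]
  · have e : (fun q => |θ q|) = -θ := by
      funext q
      rw [Subsingleton.elim q 0, h, Pi.neg_apply]
    rw [e, S.symbol_neg, Matrix.charpoly_transpose]

/-! ### The distribution of the eigenvalues -/

/-- The continuity points of any function form a Gδ set. Intersected with the interior they give a
Borel set, almost equal to `Ω`, on which `p` is continuous. -/
theorem IsRegularDomain.aemeasurable {d : ℕ} {Ω : Set (Fin d → ℝ)} {p : (Fin d → ℝ) → ℝ}
    (hΩ : IsRegularDomain Ω) (hp : ∀ᵐ x ∂(volume.restrict Ω), ContinuousWithinAt p Ω x) :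
    AEMeasurable p (volume.restrict Ω) := by
  have hm : MeasurableSet (interior Ω ∩ {x | ContinuousAt p x}) :=
    isOpen_interior.measurableSet.inter (IsGδ.setOfPred_continuousAt p).measurableSet
  have he : (interior Ω ∩ {x | ContinuousAt p x} : Set (Fin d → ℝ)) =ᵐ[volume] Ω := by
    refine EventuallyEq.trans ?_ hΩ.interior_ae_eq
    refine (LE.le.eventuallyLE Set.inter_subset_left).antisymm ?_
    filter_upwards [hΩ.ae_continuousAt hp] with x hx hxi
    exact ⟨hxi, hx hxi⟩
  rw [← Measure.restrict_congr_set he]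
  exact ContinuousOn.aemeasurable (fun x hx => hx.2.continuousWithinAt) hm

section Distribution

variable {d m ν : ℕ} [NeZero d] {S : DiamondData d m ν} {Ω : Set (Fin d → ℝ)}
  {p : (Fin d → ℝ) → ℝ}

theorem eigSum_one {V : Type*} [Fintype V] [DecidableEq V] {A : Matrix V V ℂ}
    (hA : A.IsHermitian) : eigSum (fun _ => 1) A = Fintype.card V := by
  rw [eigSum_eq_sum_eigenvalues hA]
  simp

theorem tendsto_inv_mul_card (hν : 0 < ν) (hΩ : IsRegularDomain Ω) :
    Tendsto (fun n : Fin d → ℕ => (∏ q, (n q : ℝ))⁻¹ * Fintype.card (NodeIn Ω n ν)) atTop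
      (𝓝 (ν * (volume Ω).toReal)) := by
  have := isProbabilityMeasure_uniformCube d (neg_lt_self Real.pi_pos)
  -- The nodes do not depend on the weights, so the edgeless graph suffices. Counting them is the
  -- case `F = 1`, which is bounded but not compactly supported.
  let S : DiamondData d 0 ν :=
    { mold := ⟨fun _ _ => 0, fun _ _ => rfl, fun _ => rfl⟩
      t := Fin.elim0
      t_ne_zero := fun k => k.elim0
      t_strictMono := fun k => k.elim0
      L := fun k => k.elim0
      L_ne_zero := fun k => k.elim0 }
  have h := tendsto_inv_mul_eigSum (p := fun _ => 0) (F := fun _ => 1) (M := 1) hν S hΩ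
    (Eventually.of_forall fun _ => continuousWithinAt_const) continuous_const (by simp)
  simp only [eigSum_one (gridMatrix_isHermitian _ _ _ _),
    eigSum_one (smul_symbol_isHermitian _ _ _)] at h
  have e : ∫ _ in Ω, ∫ _, ((Fintype.card (Fin ν) : ℕ) : ℂ) ∂(uniformCube d (-Real.pi) Real.pi) =
      ((ν * (volume Ω).toReal : ℝ) : ℂ) := by
    simp [measureReal_def, mul_comm]
  rw [e] at h
  have h2 := (Complex.continuous_re.tendsto _).comp h
  rw [Complex.ofReal_re] at h2
  refine h2.congr fun n => ?_
  rw [Function.comp, ← Complex.ofReal_re ((∏ q, (n q : ℝ))⁻¹ * Fintype.card (NodeIn Ω n ν))]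
  push_cast
  rfl

theorem IsRegularDomain.volume_ne_top {d : ℕ} {Ω : Set (Fin d → ℝ)} (hΩ : IsRegularDomain Ω) :
    volume Ω ≠ ⊤ :=
  ((measure_mono hΩ.subset_cube).trans_lt isCompact_Icc.measure_lt_top).ne

theorem tendsto_prod_atTop :
    Tendsto (fun n : Fin d → ℕ => ∏ q, (n q : ℝ)) atTop atTop := by
  refine tendsto_atTop_mono' _ ?_ (tendsto_eval_atTop (0 : Fin d))
  filter_upwards [eventually_ge_atTop (fun _ => 1)] with n hn
  exact_mod_cast Finset.single_le_prod' (f := fun q => n q) (fun q _ => hn q) (Finset.mem_univ 0)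

theorem tendsto_card_nodeIn (hν : 0 < ν) (hΩ : IsRegularDomain Ω) (hΩpos : 0 < volume Ω) :
    Tendsto (fun n : Fin d → ℕ => Fintype.card (NodeIn Ω n ν)) atTop atTop := by
  have hpos : 0 < (ν : ℝ) * (volume Ω).toReal :=
    mul_pos (by exact_mod_cast hν) (ENNReal.toReal_pos hΩpos.ne' hΩ.volume_ne_top)
  have h := (tendsto_inv_mul_card hν hΩ).pos_mul_atTop hpos (tendsto_prod_atTop (d := d))
  rw [← tendsto_natCast_atTop_iff (R := ℝ)]
  refine h.congr' ?_
  filter_upwards [tendsto_prod_atTop.eventually_gt_atTop 0] with n hn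
  field_simp

/-- Common form of both claims, with `a = -π` or `a = 0`; `hsymm` is all that depends on the choice
of the cube. -/
theorem eigDistributed_of_integral_eq (hν : 0 < ν) (hΩ : IsRegularDomain Ω)
    (hΩpos : 0 < volume Ω) (hp : ∀ᵐ x ∂(volume.restrict Ω), ContinuousWithinAt p Ω x)
    {a : ℝ} (ha : a < Real.pi)
    (hsymm : ∀ F : ℂ → ℂ, Continuous F → ∀ c : ℝ,
      ∫ θ, eigSum F ((c : ℂ) • S.symbol θ) ∂(uniformCube d (-Real.pi) Real.pi) =
        ∫ θ, eigSum F ((c : ℂ) • S.symbol θ) ∂(uniformCube d a Real.pi)) :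
    EigDistributed (atTop : Filter (Fin d → ℕ))
      (fun n => (gridGraphIn S Ω p n).adjMatrix.map Complex.ofReal)
      (Ω ×ˢ Set.Icc (fun _ : Fin d => a) (fun _ => Real.pi))
      (fun y : (Fin d → ℝ) × (Fin d → ℝ) => (p y.1 : ℂ) • S.symbol y.2) := by
  set C : Set (Fin d → ℝ) := Set.Icc (fun _ : Fin d => a) (fun _ => Real.pi) with hC
  have hCpos : 0 < volume C := by
    rw [hC, Real.volume_Icc_pi]
    exact pos_iff_ne_zero.2 (Finset.prod_ne_zero_iff.2 fun q _ => by simpa using ha)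
  have hCtop : volume C < ⊤ := isCompact_Icc.measure_lt_top
  have hvol : volume (Ω ×ˢ C) = volume Ω * volume C := by
    rw [Measure.volume_eq_prod, Measure.prod_prod]
  have hDtop : volume (Ω ×ˢ C) < ⊤ := hvol ▸ ENNReal.mul_lt_top hΩ.volume_ne_top.lt_top hCtop
  have hH : ∀ y : (Fin d → ℝ) × (Fin d → ℝ), ((p y.1 : ℂ) • S.symbol y.2).IsHermitian :=
    fun y => smul_symbol_isHermitian S _ _
  have hm : ∀ r s, AEMeasurable (fun y : (Fin d → ℝ) × (Fin d → ℝ) =>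
      ((p y.1 : ℂ) • S.symbol y.2) r s) (volume.restrict (Ω ×ˢ C)) := fun r s => by
    rw [Measure.volume_eq_prod, ← Measure.prod_restrict]
    exact (Complex.measurable_ofReal.comp_aemeasurable
      ((hΩ.aemeasurable hp).comp_quasiMeasurePreserving Measure.quasiMeasurePreserving_fst)).mul
      ((S.continuous_symbol_apply r s).comp continuous_snd).aemeasurable
  have hint : ∀ F : ℂ → ℂ, Continuous F → HasCompactSupport F →
      IntegrableOn (fun y : (Fin d → ℝ) × (Fin d → ℝ) =>
        eigSum F ((p y.1 : ℂ) • S.symbol y.2)) (Ω ×ˢ C) := by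
    intro F hF hFc
    obtain ⟨M, hM⟩ := hF.bounded_above_of_compact_support hFc
    simp only [eigSum_eq_sum_eigenvalues (hH _)]
    have : IsFiniteMeasure (volume.restrict (Ω ×ˢ C)) := isFiniteMeasure_restrict.2 hDtop.ne
    refine Integrable.of_bound (C := Fintype.card (Fin ν) * M)
      (aestronglyMeasurable_sum_eigenvalues hH hm (hF.comp Complex.continuous_ofReal))
      (Eventually.of_forall fun y => ?_)
    exact norm_sum_eigenvalues_le (hH y) (G := F ∘ Complex.ofReal) fun s => hM _
  refine ⟨?_, ?_, hDtop, hm, fun y _ => hH y, tendsto_card_nodeIn hν hΩ hΩpos, hint, ?_⟩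
  · exact hΩ.nullMeasurable.prod measurableSet_Icc.nullMeasurableSet
  · rw [hvol]
    exact ENNReal.mul_pos hΩpos.ne' hCpos.ne'
  · intro F hF hFc
    obtain ⟨M, hM⟩ := hF.bounded_above_of_compact_support hFc
    have h1 := tendsto_inv_mul_eigSum hν S hΩ hp hF (fun x => hM x)
    have h2 := (Complex.continuous_ofReal.tendsto _).comp (tendsto_inv_mul_card hν hΩ (d := d))
    have hne : ((ν * (volume Ω).toReal : ℝ) : ℂ) ≠ 0 := by
      rw [Complex.ofReal_ne_zero]
      exact mul_ne_zero (by exact_mod_cast hν.ne')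
        (ENNReal.toReal_pos hΩpos.ne' hΩ.volume_ne_top).ne'
    -- Eigenvalue sums and node counts are both normalized by the number of cells, which cancels in
    -- the quotient.
    have h3 := (h2.inv₀ hne).mul h1
    have e : ((volume (Ω ×ˢ C)).toReal : ℂ)⁻¹ * ∫ y in Ω ×ˢ C, (ν : ℂ)⁻¹ *
        eigSum F ((p y.1 : ℂ) • S.symbol y.2) =
        ((ν * (volume Ω).toReal : ℝ) : ℂ)⁻¹ * ∫ x in Ω, ∫ θ,
          eigSum F ((p x : ℂ) • S.symbol θ) ∂(uniformCube d (-Real.pi) Real.pi) := by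
      simp only [hsymm F hF, integral_uniformCube_eq ha]
      rw [integral_const_mul, integral_const_mul, hvol, Measure.volume_eq_prod,
        setIntegral_prod _ (hint F hF hFc), ENNReal.toReal_mul]
      push_cast
      rw [mul_inv, mul_inv]
      ring
    rw [e]
    refine h3.congr' ?_
    filter_upwards [tendsto_prod_atTop.eventually_gt_atTop 0] with n hn
    have hn' : (∏ q, (n q : ℂ)) ≠ 0 := by
      have := Complex.ofReal_ne_zero.2 hn.ne'
      push_cast at this
      exact this
    simp only [Function.comp]
    push_cast
    rw [mul_inv, inv_inv]
    field_simp

end Distribution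

end DiamondToeplitz

theorem theorem4p1 {d m ν : ℕ} [NeZero d] (hν : 0 < ν) (S : DiamondData d m ν)
    (Ω : Set (Fin d → ℝ)) (hΩ : IsRegularDomain Ω) (hΩpos : 0 < volume Ω)
    (p : (Fin d → ℝ) → ℝ)
    (hp : ∀ᵐ x ∂(volume.restrict Ω), ContinuousWithinAt p Ω x) :
    EigDistributed (atTop : Filter (Fin d → ℕ))
        (fun n => (gridGraphIn S Ω p n).adjMatrix.map Complex.ofReal)
        (Ω ×ˢ Set.Icc (fun _ : Fin d => -Real.pi) (fun _ => Real.pi))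
        (fun y : (Fin d → ℝ) × (Fin d → ℝ) => (p y.1 : ℂ) • S.symbol y.2) ∧
      ((d = 1 ∨ ∀ θ ∈ Set.Icc (fun _ : Fin d => -Real.pi) (fun _ => Real.pi),
          (S.symbol θ).charpoly = (S.symbol fun q => |θ q|).charpoly) →
        EigDistributed (atTop : Filter (Fin d → ℕ))
          (fun n => (gridGraphIn S Ω p n).adjMatrix.map Complex.ofReal)
          (Ω ×ˢ Set.Icc (fun _ : Fin d => (0 : ℝ)) (fun _ => Real.pi))
          (fun y : (Fin d → ℝ) × (Fin d → ℝ) => (p y.1 : ℂ) • S.symbol y.2)) := by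
  refine ⟨eigDistributed_of_integral_eq hν hΩ hΩpos hp (neg_lt_self Real.pi_pos)
    fun _ _ _ => rfl, fun h => ?_⟩
  have h' : ∀ θ ∈ Set.Icc (fun _ : Fin d => -Real.pi) (fun _ => Real.pi),
      (S.symbol θ).charpoly = (S.symbol fun q => |θ q|).charpoly := fun θ hθ =>
    h.elim (fun hd => charpoly_symbol_abs_of_unique hd S θ) fun h => h θ hθ
  exact eigDistributed_of_integral_eq hν hΩ hΩpos hp Real.pi_pos
    fun F hF c => integral_eigSum_symbol_eq h' hF c
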